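/- Let $\tau\in i\mathbb R_{>0}$, $p=e^{2\pi i\tau}\in(0,1)$, $(a;p)_\infty=\prod_{j\ge 0}(1-ap^j)$, and let $$\theta(x)=\theta_1(x|\tau)=ip^{1/8}e^{-\pi ix}\,(p;p)_\infty(e^{2\pi ix};p)_\infty(pe^{-2\pi ix};p)_\infty$$ be Jacobi's theta function, with the convention $\theta(u\pm v+c)=\theta(u+v+c)\,\theta(u-v+c)$. For an integer $N\ge 0$ let $\Theta_N$ be the space of entire functions $f$ satisfying $$f(x+1)=f(x),\qquad f(x+\tau)=e^{-2\pi iN(2x+\tau)}f(x),\qquad f(-x)=f(x).$$ Let $\eta\in\mathbb R_N\cup\mathbb I_N$, where $$\mathbb R_N=\Big\{\eta\in\mathbb R:\ |\eta|<\frac1{2(N+1)}\Big\},\qquad \mathbb I_N=\Big\{\eta\in i\mathbb R:\ |\eta|<\frac{\tau/i}{2(N+1)}\Big\},$$ and for $f,g\in\Theta_N$ put $$\langle f,g\rangle=\iint_{\mathbb C/(\mathbb Z+\tau\mathbb Z)}f(u)\,\overline{g(u)}\,M(u,\bar u)\,dx\,dy,\quad u=x+iy,$$ $$M(u,v)=\frac{\theta(2u)\,\theta(2v)}{e^{2\pi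 iu(N+2)}\prod_{k=0}^{N+1}\theta\big(u\pm v+(2k-N-1)\eta+\frac12+\frac\tau2\big)}.$$ Then these integrals converge absolutely, $\langle\cdot,\cdot\rangle$ is a scalar product on $\Theta_N$ (Sklyanin's invariant metric), and the reproducing kernel of $\Theta_N$ with this scalar product is $C^{-1}K_v$, where $$K_v(u)=e^{2\pi iuN}\prod_{k=0}^{N-1}\theta\Big(u\pm\bar v+(2k-N+1)\eta+\frac12+\frac\tau2\Big),\qquad C=\frac{2\eta\,p^{3/8}}{\theta(2(N+1)\eta)\,(p;p)_\infty^3};$$ for $\eta=0$, the constant $C$ is understood as its limit $\dfrac{p^{1/4}}{2\pi(N+1)(p;p)_\infty^6}$. That is, for every $v\in\mathbb C$ one has $C^{-1}K_v\in\Theta_N$ and $$f(v)=\langle f,\,C^{-1}K_v\rangle\qquad\text{for all } f\in\Theta_N.$$ -/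

import Mathlib

open Complex MeasureTheory ComplexConjugate

noncomputable section

namespace SklyaninKernel

/-- The nome `p = e^{2πiτ}`; for `τ` on the positive imaginary axis it is real with `0 < p < 1`,
so that the complex powers `p ^ s` with real `s` used below are the positive ones. -/
def nome (τ : ℂ) : ℂ := cexp (2 * Real.pi * I * τ)

/-- The infinite shifted factorial `(a; p)_∞ = ∏_{j ≥ 0} (1 - a p^j)`. -/
def qPoch (a p : ℂ) : ℂ := ∏' j : ℕ, (1 - a * p ^ j)

/-- Jacobi's theta function
`θ(x) = θ₁(x|τ) = i p^{1/8} e^{-πix} (p, e^{2πix}, p e^{-2πix}; p)_∞`. -/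
def theta (τ x : ℂ) : ℂ :=
  I * nome τ ^ (1 / 8 : ℂ) * cexp (-(Real.pi * I * x)) *
    (qPoch (nome τ) (nome τ) * qPoch (cexp (2 * Real.pi * I * x)) (nome τ) *
      qPoch (nome τ * cexp (-(2 * Real.pi * I * x))) (nome τ))

/-- The space `Θ_N` of even theta functions of order `2N`, quasi-period `(1, τ)` and zero
characteristics. -/
def Theta (τ : ℂ) (N : ℕ) : Submodule ℂ (ℂ → ℂ) where
  carrier := {f | Differentiable ℂ f ∧ (∀ x, f (x + 1) = f x) ∧
    (∀ x, f (x + τ) = cexp (-(2 * Real.pi * I * N * (2 * x + τ))) * f x) ∧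
    (∀ x, f (-x) = f x)}
  add_mem' := by
    rintro f g ⟨hf, hf1, hft, hfe⟩ ⟨hg, hg1, hgt, hge⟩
    refine ⟨hf.add hg, fun x => ?_, fun x => ?_, fun x => ?_⟩
    · simp only [Pi.add_apply, hf1, hg1]
    · simp only [Pi.add_apply, hft, hgt, mul_add]
    · simp only [Pi.add_apply, hfe, hge]
  zero_mem' := by
    refine ⟨differentiable_const 0, fun x => rfl, fun x => ?_, fun x => rfl⟩
    simp only [Pi.zero_apply, mul_zero]
  smul_mem' := by
    rintro c f ⟨hf, hf1, hft, hfe⟩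
    refine ⟨hf.const_smul c, fun x => ?_, fun x => ?_, fun x => ?_⟩
    · simp only [Pi.smul_apply, hf1]
    · simp only [Pi.smul_apply, smul_eq_mul, hft]
      ring
    · simp only [Pi.smul_apply, hfe]

/-- The weight
`M(u,v) = θ(2u) θ(2v) / (e^{2πiu(N+2)} ∏_{k=0}^{N+1} θ(u ± v + (2k-N-1)η + 1/2 + τ/2))`,
where `θ(a ± b) = θ(a + b) θ(a - b)`. -/
def weight (τ η : ℂ) (N : ℕ) (u v : ℂ) : ℂ :=
  theta τ (2 * u) * theta τ (2 * v) /
    (cexp (2 * Real.pi * I * u * (N + 2)) *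
      ∏ k ∈ Finset.range (N + 2),
        (theta τ (u + v + (2 * (k : ℂ) - N - 1) * η + 1 / 2 + τ / 2) *
          theta τ (u - v + (2 * (k : ℂ) - N - 1) * η + 1 / 2 + τ / 2)))

/-- The period rectangle `{x + iy : 0 ≤ x < 1, 0 ≤ y < Im τ}` (for `τ` purely imaginary), a
fundamental domain of `ℂ / (ℤ + τℤ)`. -/
def periodDomain (τ : ℂ) : Set ℂ := {u | u.re ∈ Set.Ico 0 1 ∧ u.im ∈ Set.Ico 0 τ.im}

/-- The integrand `f(u) \overline{g(u)} M(u, ū)` of the invariant metric. -/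
def metricIntegrand (τ η : ℂ) (N : ℕ) (f g : ℂ → ℂ) (u : ℂ) : ℂ :=
  f u * conj (g u) * weight τ η N u (conj u)

/-- Sklyanin's invariant metric: the integral of `f(u) \overline{g(u)} M(u, ū) dx dy`, `u = x + iy`,
over `ℂ / (ℤ + τℤ)`. -/
def metric (τ η : ℂ) (N : ℕ) (f g : ℂ → ℂ) : ℂ :=
  ∫ u in periodDomain τ, metricIntegrand τ η N f g u

/-- `B` restricts to a scalar product (linear in the first argument) on the space `V` of
functions. -/
structure IsScalarProduct (V : Submodule ℂ (ℂ → ℂ)) (B : (ℂ → ℂ) → (ℂ → ℂ) → ℂ) : Prop where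
  add_left : ∀ f ∈ V, ∀ g ∈ V, ∀ h ∈ V, B (f + g) h = B f h + B g h
  smul_left : ∀ c : ℂ, ∀ f ∈ V, ∀ g ∈ V, B (c • f) g = c * B f g
  conj_symm : ∀ f ∈ V, ∀ g ∈ V, conj (B f g) = B g f
  pos_def : ∀ f ∈ V, f ≠ 0 → 0 < (B f f).re

/-- `k` is the reproducing kernel of the function space `V` with the scalar product `B`:
`k_v ∈ V` and `f(v) = ⟨f, k_v⟩` for all `v` and all `f ∈ V`. -/
structure IsReproducingKernel (V : Submodule ℂ (ℂ → ℂ)) (B : (ℂ → ℂ) → (ℂ → ℂ) → ℂ)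
    (k : ℂ → ℂ → ℂ) : Prop where
  scalarProduct : IsScalarProduct V B
  mem : ∀ v, k v ∈ V
  reproducing : ∀ f ∈ V, ∀ v, f v = B f (k v)

/-- `ℝ_N = {η ∈ ℝ : |η| < 1 / (2(N+1))}`. -/
def realRange (N : ℕ) : Set ℂ := {η | η.im = 0 ∧ ‖η‖ < 1 / (2 * ((N : ℝ) + 1))}

/-- `𝕀_N = {η ∈ iℝ : |η| < (τ/i) / (2(N+1))}` (for `τ` purely imaginary, `τ/i = Im τ`). -/
def imagRange (τ : ℂ) (N : ℕ) : Set ℂ := {η | η.re = 0 ∧ ‖η‖ < τ.im / (2 * ((N : ℝ) + 1))}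

/-- `K_v(u) = e^{2πiuN} ∏_{k=0}^{N-1} θ(u ± v̄ + (2k-N+1)η + 1/2 + τ/2)`. -/
def sklyaninKernel (τ η : ℂ) (N : ℕ) (v u : ℂ) : ℂ :=
  cexp (2 * Real.pi * I * u * N) *
    ∏ k ∈ Finset.range N,
      (theta τ (u + conj v + (2 * (k : ℂ) - N + 1) * η + 1 / 2 + τ / 2) *
        theta τ (u - conj v + (2 * (k : ℂ) - N + 1) * η + 1 / 2 + τ / 2))

open Classical in
/-- The constant `C = 2 η p^{3/8} / (θ(2(N+1)η) (p;p)_∞³)`; at `η = 0`, where this expression has a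
removable singularity, it is given by its limit `p^{1/4} / (2π(N+1) (p;p)_∞⁶)`. -/
def kernelConst (τ η : ℂ) (N : ℕ) : ℂ :=
  if η = 0 then
    nome τ ^ (1 / 4 : ℂ) / (2 * Real.pi * (N + 1) * qPoch (nome τ) (nome τ) ^ 6)
  else
    2 * η * nome τ ^ (3 / 8 : ℂ) /
      (theta τ (2 * (N + 1) * η) * qPoch (nome τ) (nome τ) ^ 3)

end SklyaninKernel

end

noncomputable section

namespace SklyaninKernel

open scoped ComplexOrder
open Filter Topology

/-! ### The shifted factorial -/

/-! The reproducing integrand is, up to a constant, an average of antiholomorphic derivatives, so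
Stokes' theorem on the period rectangle evaluates the integral.

Write `P_n(v, w)` for `thetaProd`, `q(u) = θ(v ± u)` and `A(w) = P_{N+1}(v, w) / P_{N+1}(u, w)`. Up
to a constant, the conjugated kernel times the weight is `θ(2u) θ(2w) P_N(v, w) / P_{N+2}(u, w)` at
`w = ū`. By Weierstrass' addition formula (`theta_addition`), `A(w + η) - A(w - η)` equals
`θ(2(N+1)η) q(u) θ(2w) P_N(v, w) / P_{N+2}(u, w)` (`thetaRatio_sub`). With `h(u) = f(u) θ(2u) /
q(u)`, the integrand is therefore a constant times the integral over `t ∈ [-1, 1]` of `h(u) A'(ū +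
tη)` (`metricIntegrand_kernel_eq`); written this way the identity survives at `η = 0`, where the
difference becomes a derivative.

For fixed `t`, `h(u) A'(ū + tη)` is the `∂̄`-derivative of `h(u) A(ū + tη)`. That primitive is
doubly periodic but has poles at the zeros of `q`. Since `A = 1` at `u = ±v`, the poles are
cancelled by adding the meromorphic function `f(v) q' / (θ'(0) q)`, which does not change `∂̄`. The
sum `prim` is continuous, has period `1`, and drops by `4πi f(v) / θ'(0)` under `u ↦ u + τ`. Stokes
then gives `2π f(v) / θ'(0)` for every `t` (`integral_dbarPrim`), and integration over `t` produces
`C f(v)`.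

This needs simple zeros of `q`, that is `2v ∉ ℤ + τℤ`; the remaining `v` follow by continuity
(`metric_kernel`). Positivity and convergence come from the bound on `η`: `P_{N+2}(u, ū)` factors
into products of `θ₃` along the steps `η` based at the real point `2 Re u` and at the imaginary
point `-2i Im u`, and these are positive (`thetaProd_pos`). -/

lemma summable_norm_mul_pow (a : ℂ) {p : ℂ} (hp : ‖p‖ < 1) :
    Summable fun j : ℕ => ‖-(a * p ^ j)‖ := by
  simpa using (summable_geometric_of_lt_one (norm_nonneg _) hp).mul_left ‖a‖

lemma multipliable_qPoch (a : ℂ) {p : ℂ} (hp : ‖p‖ < 1) :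
    Multipliable fun j : ℕ => 1 - a * p ^ j := by
  simpa [sub_eq_add_neg] using multipliable_one_add_of_summable (summable_norm_mul_pow a hp)

lemma qPoch_step (a : ℂ) {p : ℂ} (hp : ‖p‖ < 1) :
    qPoch a p = (1 - a) * qPoch (p * a) p := by
  have h : ∀ j : ℕ, 1 - a * p ^ (j + 1) = 1 - p * a * p ^ j := fun j => by ring
  have := tprod_eq_zero_mul' (f := fun j : ℕ => 1 - a * p ^ j)
    (by simpa only [h] using multipliable_qPoch (p * a) hp)
  simpa only [qPoch, h, pow_zero, mul_one] using this

lemma qPoch_ne_zero {a p : ℂ} (hp : ‖p‖ < 1) (h : ∀ j : ℕ, a * p ^ j ≠ 1) : qPoch a p ≠ 0 := by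
  have := tprod_one_add_ne_zero_of_summable (f := fun j : ℕ => -(a * p ^ j))
    (fun j => by rw [← sub_eq_add_neg]; exact sub_ne_zero.mpr (h j).symm)
    (summable_norm_mul_pow a hp)
  simp only [← sub_eq_add_neg] at this
  exact this

lemma conj_qPoch (a p : ℂ) : conj (qPoch a p) = qPoch (conj a) (conj p) := by
  have := Function.LeftInverse.map_tprod (f := fun j : ℕ => 1 - a * p ^ j)
    (g := starRingEnd ℂ) (g' := starRingEnd ℂ) continuous_conj continuous_conj
    (fun x => by simp) (L := SummationFilter.unconditional ℕ)
  simpa [qPoch] using this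

/-- Positive factors alone do not exclude the limit `0`; here the logarithms are summable, so the
product is the exponential of a real number. -/
lemma qPoch_pos {a p : ℝ} (hp : |p| < 1) (h : ∀ j : ℕ, 0 < 1 - a * p ^ j) :
    (0 : ℂ) < qPoch a p := by
  have h1 : qPoch a p = ((∏' j : ℕ, (1 - a * p ^ j) : ℝ) : ℂ) := by
    have := Multipliable.map_tprod (f := fun j : ℕ => 1 - a * p ^ j)
      (L := SummationFilter.unconditional ℕ) (g := Complex.ofRealHom) (by
        simpa [sub_eq_add_neg] using multipliable_one_add_of_summable
          (f := fun j : ℕ => -(a * p ^ j)) (by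
            simpa using (summable_geometric_of_lt_one (abs_nonneg _) hp).mul_left |a|))
        Complex.continuous_ofReal
    simpa [qPoch] using this.symm
  rw [h1, Complex.zero_lt_real]
  have h2 := Real.rexp_tsum_eq_tprod h (by
    have := Real.summable_log_one_add_of_summable (f := fun j : ℕ => -(a * p ^ j))
      (Summable.of_norm (by
        simpa using (summable_geometric_of_lt_one (abs_nonneg _) hp).mul_left |a|))
    simpa [sub_eq_add_neg] using this)
  rw [← h2]
  exact Real.exp_pos _

lemma differentiable_qPoch {p : ℂ} (hp : ‖p‖ < 1) : Differentiable ℂ fun a => qPoch a p := by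
  have key : HasProdLocallyUniformlyOn (fun (j : ℕ) (a : ℂ) => 1 + -(a * p ^ j))
      (fun a => ∏' j : ℕ, (1 + -(a * p ^ j))) Set.univ := by
    apply hasProdLocallyUniformlyOn_of_forall_compact isOpen_univ
    intro K _ hK
    obtain ⟨R, hR⟩ := hK.isBounded.exists_norm_le
    -- On a compact set with `‖a‖ ≤ R` the terms are dominated by `R ‖p‖ ^ j`, which gives uniform
    -- convergence.
    refine ((summable_geometric_of_lt_one (norm_nonneg _) hp).mul_left R).hasProdUniformlyOn_nat_one_add
      hK (.of_forall fun n x hx ↦ ?_) (fun _ ↦ by fun_prop)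
    simpa using mul_le_mul_of_nonneg_right (hR x hx) (by positivity)
  have := key.differentiableOn (.of_forall fun s ↦ (Differentiable.fun_finsetProd
      (f := fun (j : ℕ) (a : ℂ) => 1 + -(a * p ^ j)) fun _ _ ↦ by fun_prop).differentiableOn)
      isOpen_univ
  rw [differentiableOn_univ] at this
  simpa only [qPoch, sub_eq_add_neg] using this

/-! ### The period lattice and the nome -/

/-- The lattice `ℤ + τℤ`. -/
def lattice (τ : ℂ) : AddSubgroup ℂ := AddSubgroup.closure {1, τ}

lemma mem_lattice {τ x : ℂ} : x ∈ lattice τ ↔ ∃ m n : ℤ, x = m + n * τ := by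
  simp [lattice, AddSubgroup.mem_closure_pair, eq_comm]

lemma countable_lattice (τ : ℂ) : (lattice τ : Set ℂ).Countable := by
  refine (Set.countable_range fun k : ℤ × ℤ => (k.1 : ℂ) + k.2 * τ).mono fun x hx => ?_
  obtain ⟨m, n, h⟩ := mem_lattice.mp hx
  exact ⟨(m, n), h.symm⟩

/-- Induction along translations by the generators of the lattice. -/
lemma lattice_induction {τ : ℂ} {S : ℂ → Prop} (h1 : ∀ x, S (x + 1) ↔ S x)
    (hτ : ∀ x, S (x + τ) ↔ S x) {l : ℂ} (hl : l ∈ lattice τ) (x : ℂ) : S (x + l) ↔ S x := by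
  induction hl using AddSubgroup.closure_induction generalizing x with
  | mem y hy => rcases hy with rfl | rfl <;> [exact h1 x; exact hτ x]
  | zero => simp
  | add y z _ _ hy hz => rw [← add_assoc, hz, hy]
  | neg y _ hy => simpa using (hy (x + -y)).symm

lemma nome_eq_ofReal {τ : ℂ} (hτ : τ.re = 0) :
    nome τ = (Real.exp (-(2 * Real.pi * τ.im)) : ℝ) := by
  obtain ⟨t, rfl⟩ : ∃ t : ℝ, τ = t * I := ⟨τ.im, by apply Complex.ext <;> simp [hτ]⟩
  rw [nome]
  push_cast
  congr 1
  simp only [mul_im, ofReal_re, I_im, ofReal_im, I_re, mul_one, mul_zero, add_zero]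
  linear_combination (2 * (Real.pi : ℂ) * t) * I_mul_I

lemma norm_nome_lt_one {τ : ℂ} (hτ' : 0 < τ.im) : ‖nome τ‖ < 1 := by
  rw [nome, Complex.norm_exp]
  simp only [mul_re, re_ofNat, ofReal_re, im_ofNat, ofReal_im, I_re, I_im, mul_im]
  rw [Real.exp_lt_one_iff]
  have := Real.pi_pos
  nlinarith [mul_pos this hτ']

/-- Since `τ` is imaginary, `2πiτ` is real, hence it is the principal logarithm of the nome. -/
lemma nome_cpow {τ : ℂ} (hτ : τ.re = 0) (s : ℂ) :
    nome τ ^ s = cexp (2 * Real.pi * I * τ * s) := by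
  have h0 : (2 * Real.pi * I * τ).im = 0 := by simp [hτ]
  rw [nome, cpow_def_of_ne_zero (Complex.exp_ne_zero _), Complex.log_exp] <;>
    rw [h0] <;> linarith [Real.pi_pos]

lemma conj_nome {τ : ℂ} (hτ : τ.re = 0) : conj (nome τ) = nome τ := by
  rw [nome_eq_ofReal hτ, conj_ofReal]

lemma qPoch_nome_pos {τ : ℂ} (hτ : τ.re = 0) (hτ' : 0 < τ.im) :
    0 < qPoch (nome τ) (nome τ) := by
  have h := norm_nome_lt_one hτ'
  rw [nome_eq_ofReal hτ] at h ⊢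
  have h0 := Real.exp_pos (-(2 * Real.pi * τ.im))
  set r := Real.exp (-(2 * Real.pi * τ.im))
  rw [norm_real, Real.norm_eq_abs] at h
  refine qPoch_pos h fun j => ?_
  rw [abs_of_pos h0] at h
  rw [← pow_succ', sub_pos]
  exact pow_lt_one₀ h0.le h (by simp)

/-! ### Jacobi's theta function -/

lemma theta_eq {τ : ℂ} (hτ : τ.re = 0) (x : ℂ) :
    theta τ x = I * cexp (Real.pi * I * τ / 4) * cexp (-(Real.pi * I * x)) *
    (qPoch (nome τ) (nome τ) * qPoch (cexp (2 * Real.pi * I * x)) (nome τ) *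
      qPoch (nome τ * cexp (-(2 * Real.pi * I * x))) (nome τ)) := by
  rw [theta, nome_cpow hτ]; ring_nf

@[fun_prop]
lemma differentiable_theta {τ : ℂ} (hτ' : 0 < τ.im) : Differentiable ℂ (theta τ) := by
  have h := differentiable_qPoch (norm_nome_lt_one hτ')
  have h1 : Differentiable ℂ fun x => qPoch (cexp (2 * Real.pi * I * x)) (nome τ) :=
    h.comp (by fun_prop)
  have h2 : Differentiable ℂ fun x => qPoch (nome τ * cexp (-(2 * Real.pi * I * x))) (nome τ) :=
    h.comp (by fun_prop)
  unfold theta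
  fun_prop

@[fun_prop]
lemma continuous_theta {τ : ℂ} (hτ' : 0 < τ.im) : Continuous (theta τ) :=
  (differentiable_theta hτ').continuous

@[fun_prop]
lemma contDiff_theta {τ : ℂ} (hτ' : 0 < τ.im) {n : WithTop ℕ∞} : ContDiff ℂ n (theta τ) :=
  (differentiable_theta hτ').contDiff

lemma exp_two_pi_add_one (x : ℂ) : cexp (2 * Real.pi * I * (x + 1)) = cexp (2 * Real.pi * I * x) := by
  rw [mul_add, mul_one, Complex.exp_add, Complex.exp_two_pi_mul_I, mul_one]

lemma exp_neg_two_pi_add_one (x : ℂ) :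
    cexp (-(2 * Real.pi * I * (x + 1))) = cexp (-(2 * Real.pi * I * x)) := by
  rw [Complex.exp_neg, exp_two_pi_add_one, Complex.exp_neg]

lemma theta_add_one (τ x : ℂ) : theta τ (x + 1) = -theta τ x := by
  have h : cexp (-(Real.pi * I * (x + 1))) = -cexp (-(Real.pi * I * x)) := by
    rw [mul_add, neg_add, Complex.exp_add, mul_one, Complex.exp_neg (Real.pi * I),
      Complex.exp_pi_mul_I]; norm_num
  simp only [theta, h, exp_two_pi_add_one, exp_neg_two_pi_add_one]
  ring

/-- Inversion of the argument in the product `(a; p)_∞ (p / a; p)_∞`. -/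
lemma qPoch_inv_mul {a p : ℂ} (hp : ‖p‖ < 1) (ha : a ≠ 0) :
    qPoch (p * a) p * qPoch a⁻¹ p = -a⁻¹ * (qPoch a p * qPoch (p * a⁻¹) p) := by
  rw [qPoch_step a hp, qPoch_step a⁻¹ hp]
  field_simp
  ring

lemma theta_add_tau {τ : ℂ} (hτ : τ.re = 0) (hτ' : 0 < τ.im) (x : ℂ) :
    theta τ (x + τ) = -cexp (-(Real.pi * I * τ)) * cexp (-(2 * Real.pi * I * x)) * theta τ x := by
  rw [theta_eq hτ, theta_eq hτ]
  have h1 : cexp (2 * Real.pi * I * (x + τ)) = nome τ * cexp (2 * Real.pi * I * x) := by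
    rw [nome, ← Complex.exp_add]; ring_nf
  have h2 : nome τ * cexp (-(2 * Real.pi * I * (x + τ))) = (cexp (2 * Real.pi * I * x))⁻¹ := by
    rw [nome, ← Complex.exp_add, ← Complex.exp_neg]; ring_nf
  have h3 : cexp (-(Real.pi * I * (x + τ))) =
      cexp (-(Real.pi * I * τ)) * cexp (-(Real.pi * I * x)) := by
    rw [← Complex.exp_add]; ring_nf
  have key := qPoch_inv_mul (norm_nome_lt_one hτ') (Complex.exp_ne_zero (2 * Real.pi * I * x))
  rw [h1, h2, h3, Complex.exp_neg (2 * Real.pi * I * x)]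
  linear_combination (I * cexp (Real.pi * I * τ / 4) * (cexp (-(Real.pi * I * τ)) *
    cexp (-(Real.pi * I * x))) * qPoch (nome τ) (nome τ)) * key

lemma theta_neg {τ : ℂ} (hτ' : 0 < τ.im) (x : ℂ) : theta τ (-x) = -theta τ x := by
  have h1 : cexp (2 * Real.pi * I * (-x)) = (cexp (2 * Real.pi * I * x))⁻¹ := by
    rw [← Complex.exp_neg]; ring_nf
  have h2 : cexp (-(2 * Real.pi * I * (-x))) = cexp (2 * Real.pi * I * x) := by ring_nf
  have h3 : cexp (-(Real.pi * I * (-x))) =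
      cexp (-(Real.pi * I * x)) * cexp (2 * Real.pi * I * x) := by
    rw [← Complex.exp_add]; ring_nf
  have key := qPoch_inv_mul (norm_nome_lt_one hτ') (Complex.exp_ne_zero (2 * Real.pi * I * x))
  have h4 := Complex.exp_ne_zero (2 * Real.pi * I * x)
  rw [theta, theta, h1, h2, h3, Complex.exp_neg (2 * Real.pi * I * x)]
  set a := cexp (2 * Real.pi * I * x)
  have h5 : a * a⁻¹ = 1 := mul_inv_cancel₀ h4
  linear_combination (I * nome τ ^ (1 / 8 : ℂ) * cexp (-(Real.pi * I * x)) * a *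
    qPoch (nome τ) (nome τ)) * key - (I * nome τ ^ (1 / 8 : ℂ) * cexp (-(Real.pi * I * x)) *
    qPoch (nome τ) (nome τ) * qPoch a (nome τ) * qPoch (nome τ * a⁻¹) (nome τ)) * h5

lemma exists_eq_of_exp_eq_one {x : ℂ} (h : cexp (2 * Real.pi * I * x) = 1) : ∃ n : ℤ, x = n := by
  obtain ⟨n, hn⟩ := Complex.exp_eq_one_iff.mp h
  exact ⟨n, mul_left_cancel₀ Complex.two_pi_I_ne_zero (by rw [hn]; ring)⟩

lemma theta_zero (τ : ℂ) : theta τ 0 = 0 := by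
  have : qPoch 1 (nome τ) = 0 := tprod_of_exists_eq_zero ⟨0, by simp⟩
  simp [theta, this]

lemma theta_eq_zero_iff {τ : ℂ} (hτ : τ.re = 0) (hτ' : 0 < τ.im) {x : ℂ} :
    theta τ x = 0 ↔ x ∈ lattice τ := by
  have hp := norm_nome_lt_one hτ'
  constructor
  · intro h
    by_contra hx
    rw [mem_lattice] at hx
    push Not at hx
    have h1 : qPoch (cexp (2 * Real.pi * I * x)) (nome τ) ≠ 0 := by
      refine qPoch_ne_zero hp fun j hj => ?_
      rw [nome, ← Complex.exp_nat_mul, ← Complex.exp_add] at hj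
      obtain ⟨n, hn⟩ := exists_eq_of_exp_eq_one (x := x + j * τ) (by rw [← hj]; ring_nf)
      exact hx n (-j) (by push_cast; linear_combination hn)
    have h2 : qPoch (nome τ * cexp (-(2 * Real.pi * I * x))) (nome τ) ≠ 0 := by
      refine qPoch_ne_zero hp fun j hj => ?_
      rw [nome, ← Complex.exp_nat_mul, ← Complex.exp_add, ← Complex.exp_add] at hj
      obtain ⟨n, hn⟩ := exists_eq_of_exp_eq_one (x := τ - x + j * τ) (by rw [← hj]; ring_nf)
      exact hx (-n) (j + 1) (by push_cast; linear_combination -hn)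
    have h3 := (qPoch_nome_pos hτ hτ').ne'
    rw [theta_eq hτ] at h
    simp [h1, h2, h3, Complex.exp_ne_zero] at h
  · intro h
    have := lattice_induction (S := fun x => theta τ x = 0) (τ := τ)
      (fun x => by rw [theta_add_one, neg_eq_zero])
      (fun x => by rw [theta_add_tau hτ hτ']; simp [Complex.exp_ne_zero]) h 0
    rw [zero_add] at this
    exact this.mpr (theta_zero τ)

lemma hasDerivAt_theta_zero {τ : ℂ} (hτ : τ.re = 0) (hτ' : 0 < τ.im) :
    HasDerivAt (theta τ)
      (2 * Real.pi * cexp (Real.pi * I * τ / 4) * qPoch (nome τ) (nome τ) ^ 3) 0 := by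
  have hp := norm_nome_lt_one hτ'
  have h := differentiable_qPoch hp
  -- The cofactor of the single factor `1 - e^{2πix}` responsible for the zero at the origin; only
  -- its value at `0` enters the derivative.
  set g : ℂ → ℂ := fun x => I * cexp (Real.pi * I * τ / 4) * cexp (-(Real.pi * I * x)) *
    (qPoch (nome τ) (nome τ) * qPoch (nome τ * cexp (2 * Real.pi * I * x)) (nome τ) *
      qPoch (nome τ * cexp (-(2 * Real.pi * I * x))) (nome τ)) with hg
  have hgd : Differentiable ℂ g := by
    have h1 : Differentiable ℂ fun x => qPoch (nome τ * cexp (2 * Real.pi * I * x)) (nome τ) :=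
      h.comp (by fun_prop)
    have h2 : Differentiable ℂ fun x => qPoch (nome τ * cexp (-(2 * Real.pi * I * x))) (nome τ) :=
      h.comp (by fun_prop)
    rw [hg]
    fun_prop
  have he : theta τ = fun x => (1 - cexp (2 * Real.pi * I * x)) * g x := by
    funext x
    rw [theta_eq hτ, qPoch_step (cexp (2 * Real.pi * I * x)) hp]; simp only [hg]; ring
  have h1 : HasDerivAt (fun x : ℂ => 1 - cexp (2 * Real.pi * I * x)) (-(2 * Real.pi * I)) 0 := by
    have := (((hasDerivAt_id (0 : ℂ)).const_mul (2 * Real.pi * I)).cexp).const_sub 1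
    simpa using this
  have := h1.mul (hgd 0).hasDerivAt
  rw [he]
  refine this.congr_deriv ?_
  simp only [hg, mul_zero, neg_zero, Complex.exp_zero, mul_one, sub_self, zero_mul, add_zero]
  linear_combination (-2 * Real.pi * cexp (Real.pi * I * τ / 4) * qPoch (nome τ) (nome τ) ^ 3)
    * I_mul_I

/-- The derivative `θ'(0) = 2π p^{1/8} (p; p)_∞³`. -/
def thetaDerivZero (τ : ℂ) : ℂ :=
  2 * Real.pi * cexp (Real.pi * I * τ / 4) * qPoch (nome τ) (nome τ) ^ 3

lemma thetaDerivZero_ne_zero {τ : ℂ} (hτ : τ.re = 0) (hτ' : 0 < τ.im) : thetaDerivZero τ ≠ 0 := by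
  have := (qPoch_nome_pos hτ hτ').ne'
  simp [thetaDerivZero, this, Complex.exp_ne_zero, Real.pi_ne_zero]

lemma deriv_theta_add_one {τ : ℂ} (x : ℂ) : deriv (theta τ) (x + 1) = -deriv (theta τ) x := by
  have h : (fun y => theta τ (y + 1)) = fun y => -theta τ y := funext fun y => theta_add_one τ y
  have := congrArg (fun f => deriv f x) h
  simpa [deriv_comp_add_const] using this

lemma deriv_theta_add_tau {τ : ℂ} (hτ : τ.re = 0) (hτ' : 0 < τ.im) (x : ℂ) :
    deriv (theta τ) (x + τ) = -cexp (-(Real.pi * I * τ)) * cexp (-(2 * Real.pi * I * x)) *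
      (deriv (theta τ) x - 2 * Real.pi * I * theta τ x) := by
  have h : (fun y => theta τ (y + τ)) = fun y =>
      -cexp (-(Real.pi * I * τ)) * cexp (-(2 * Real.pi * I * y)) * theta τ y :=
    funext fun y => theta_add_tau hτ hτ' y
  have h1 := congrArg (fun f => deriv f x) h
  simp only [deriv_comp_add_const] at h1
  rw [h1]
  have h2 : HasDerivAt (fun y : ℂ => cexp (-(2 * Real.pi * I * y)))
      (cexp (-(2 * Real.pi * I * x)) * (-(2 * Real.pi * I))) x := by
    simpa using (((hasDerivAt_id x).const_mul (2 * Real.pi * I)).neg).cexp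
  have h3 := (h2.const_mul (-cexp (-(Real.pi * I * τ)))).mul
    (differentiable_theta hτ' x).hasDerivAt
  refine h3.deriv.trans ?_
  ring

lemma deriv_theta_ne_zero {τ : ℂ} (hτ : τ.re = 0) (hτ' : 0 < τ.im) {x : ℂ}
    (hx : x ∈ lattice τ) : deriv (theta τ) x ≠ 0 := by
  -- Translation by `τ` mixes `θ'` with `θ`, so nonvanishing of `θ'` is only transported where `θ =
  -- 0`.
  have := lattice_induction (S := fun x => theta τ x = 0 → deriv (theta τ) x ≠ 0) (τ := τ)
    (fun x => by simp only [theta_add_one, deriv_theta_add_one, neg_eq_zero, ne_eq])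
    (fun x => by
      rw [theta_add_tau hτ hτ', deriv_theta_add_tau hτ hτ']
      simp +contextual [Complex.exp_ne_zero]) hx 0
  rw [zero_add] at this
  refine this.mpr (fun _ => ?_) ((theta_eq_zero_iff hτ hτ').mpr hx)
  rw [(hasDerivAt_theta_zero hτ hτ').deriv]
  exact thetaDerivZero_ne_zero hτ hτ'

lemma conj_theta {τ : ℂ} (hτ : τ.re = 0) (hτ' : 0 < τ.im) (x : ℂ) :
    conj (theta τ x) = theta τ (conj x) := by
  -- Conjugation flips the sign of the leading `i` and of the exponents `2πix`, so it naturally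
  -- yields `-θ(-x̄)`; oddness restores the stated form.
  rw [← neg_neg (theta τ (conj x)), ← theta_neg hτ', theta_eq hτ, theta_eq hτ]
  have hc : conj τ = -τ := by apply Complex.ext <;> simp [hτ]
  simp only [map_mul, conj_qPoch, conj_nome hτ, ← Complex.exp_conj, map_neg, map_ofNat, conj_ofReal,
    conj_I, map_div₀, hc]
  ring_nf

/-! ### The shifted theta function -/

/-- The theta function `p^{1/8} e^{πiz} θ(z + 1/2 + τ/2)`, which is even and positive on both
coordinate axes. -/
def theta3 (τ z : ℂ) : ℂ :=
  qPoch (nome τ) (nome τ) * qPoch (-(cexp (Real.pi * I * τ) * cexp (2 * Real.pi * I * z))) (nome τ) *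
    qPoch (-(cexp (Real.pi * I * τ) * cexp (-(2 * Real.pi * I * z)))) (nome τ)

lemma theta_shift {τ : ℂ} (hτ : τ.re = 0) (z : ℂ) :
    theta τ (z + 1 / 2 + τ / 2) =
      cexp (-(Real.pi * I * τ / 4)) * cexp (-(Real.pi * I * z)) * theta3 τ z := by
  have h1 : cexp (2 * Real.pi * I * (z + 1 / 2 + τ / 2)) =
      -(cexp (Real.pi * I * τ) * cexp (2 * Real.pi * I * z)) := by
    rw [show 2 * Real.pi * I * (z + 1 / 2 + τ / 2) =
      Real.pi * I * τ + 2 * Real.pi * I * z + Real.pi * I by ring, Complex.exp_add,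
      Complex.exp_add, Complex.exp_pi_mul_I]
    ring
  have h2 : nome τ * cexp (-(2 * Real.pi * I * (z + 1 / 2 + τ / 2))) =
      -(cexp (Real.pi * I * τ) * cexp (-(2 * Real.pi * I * z))) := by
    rw [nome, ← Complex.exp_add, show 2 * Real.pi * I * τ + -(2 * Real.pi * I * (z + 1 / 2 + τ / 2)) =
      Real.pi * I * τ + -(2 * Real.pi * I * z) + -(Real.pi * I) by ring, Complex.exp_add,
      Complex.exp_add, Complex.exp_neg (Real.pi * I), Complex.exp_pi_mul_I]
    norm_num
  have h3 : I * cexp (Real.pi * I * τ / 4) * cexp (-(Real.pi * I * (z + 1 / 2 + τ / 2))) =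
      cexp (-(Real.pi * I * τ / 4)) * cexp (-(Real.pi * I * z)) := by
    rw [mul_assoc, ← Complex.exp_add, ← Complex.exp_add,
      show Real.pi * I * τ / 4 + -(Real.pi * I * (z + 1 / 2 + τ / 2)) =
      -(Real.pi * I * τ / 4) + -(Real.pi * I * z) + -(Real.pi / 2 * I) by ring, Complex.exp_add,
      Complex.exp_neg (Real.pi / 2 * I), Complex.exp_pi_div_two_mul_I, inv_I]
    linear_combination (-cexp (-(Real.pi * I * τ / 4) + -(Real.pi * I * z))) * I_mul_I
  rw [theta_eq hτ, h1, h2, h3, theta3]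

lemma theta3_add_one (τ z : ℂ) : theta3 τ (z + 1) = theta3 τ z := by
  simp only [theta3, exp_two_pi_add_one, exp_neg_two_pi_add_one]

lemma theta3_neg (τ z : ℂ) : theta3 τ (-z) = theta3 τ z := by
  simp only [theta3, mul_neg, neg_neg]
  ring

lemma theta3_eq {τ : ℂ} (hτ : τ.re = 0) (z : ℂ) :
    theta3 τ z = cexp (Real.pi * I * τ / 4) * cexp (Real.pi * I * z) *
      theta τ (z + 1 / 2 + τ / 2) := by
  rw [theta_shift hτ, Complex.exp_neg, Complex.exp_neg]
  field_simp

lemma theta3_add_tau {τ : ℂ} (hτ : τ.re = 0) (hτ' : 0 < τ.im) (z : ℂ) :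
    theta3 τ (z + τ) = cexp (-(Real.pi * I * τ)) * cexp (-(2 * Real.pi * I * z)) * theta3 τ z := by
  rw [theta3_eq hτ, theta3_eq hτ, show z + τ + 1 / 2 + τ / 2 = z + 1 / 2 + τ / 2 + τ by ring,
    theta_add_tau hτ hτ']
  have h : cexp (Real.pi * I * (z + τ)) * -cexp (-(Real.pi * I * τ)) *
      cexp (-(2 * Real.pi * I * (z + 1 / 2 + τ / 2))) =
      cexp (-(Real.pi * I * τ)) * cexp (-(2 * Real.pi * I * z)) * cexp (Real.pi * I * z) := by
    rw [mul_neg, ← Complex.exp_add, neg_mul, ← Complex.exp_add, ← Complex.exp_add,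
      ← Complex.exp_add,
      show Real.pi * I * (z + τ) + -(Real.pi * I * τ) + -(2 * Real.pi * I * (z + 1 / 2 + τ / 2)) =
        -(Real.pi * I * τ) + -(2 * Real.pi * I * z) + Real.pi * I * z + -(Real.pi * I) by ring,
      Complex.exp_add _ (-(Real.pi * I)), Complex.exp_neg (Real.pi * I), Complex.exp_pi_mul_I]
    norm_num
  linear_combination (cexp (Real.pi * I * τ / 4) * theta τ (z + 1 / 2 + τ / 2)) * h

lemma theta3_eq_zero_iff {τ : ℂ} (hτ : τ.re = 0) (hτ' : 0 < τ.im) {z : ℂ} :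
    theta3 τ z = 0 ↔ z + 1 / 2 + τ / 2 ∈ lattice τ := by
  rw [theta3_eq hτ, ← theta_eq_zero_iff hτ hτ']
  simp [Complex.exp_ne_zero]

lemma theta3_ne_zero_of_im {τ : ℂ} (hτ : τ.re = 0) (hτ' : 0 < τ.im) {z : ℂ}
    (hz : |z.im| < τ.im / 2) : theta3 τ z ≠ 0 := by
  rw [Ne, theta3_eq_zero_iff hτ hτ', mem_lattice]
  rintro ⟨m, n, h⟩
  have h := congrArg Complex.im h
  simp at h
  rw [abs_lt] at hz
  have h1 : (n : ℝ) < 1 := by nlinarith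
  have h2 : (0 : ℝ) < n := by nlinarith
  norm_cast at h1 h2
  omega

lemma theta3_ne_zero_of_re {τ : ℂ} (hτ : τ.re = 0) (hτ' : 0 < τ.im) {z : ℂ}
    (hz : |z.re| < 1 / 2) : theta3 τ z ≠ 0 := by
  rw [Ne, theta3_eq_zero_iff hτ hτ', mem_lattice]
  rintro ⟨m, n, h⟩
  have h := congrArg Complex.re h
  simp [hτ] at h
  rw [abs_lt] at hz
  have h1 : (m : ℝ) < 1 := by linarith
  have h2 : (0 : ℝ) < m := by linarith
  norm_cast at h1 h2
  omega

@[fun_prop]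
lemma differentiable_theta3 {τ : ℂ} (hτ' : 0 < τ.im) : Differentiable ℂ (theta3 τ) := by
  have h := differentiable_qPoch (norm_nome_lt_one hτ')
  have h1 : Differentiable ℂ fun z =>
      qPoch (-(cexp (Real.pi * I * τ) * cexp (2 * Real.pi * I * z))) (nome τ) :=
    h.comp (by fun_prop)
  have h2 : Differentiable ℂ fun z =>
      qPoch (-(cexp (Real.pi * I * τ) * cexp (-(2 * Real.pi * I * z)))) (nome τ) :=
    h.comp (by fun_prop)
  unfold theta3
  fun_prop

@[fun_prop]
lemma continuous_theta3 {τ : ℂ} (hτ' : 0 < τ.im) : Continuous (theta3 τ) :=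
  (differentiable_theta3 hτ').continuous

@[fun_prop]
lemma contDiff_theta3 {τ : ℂ} (hτ' : 0 < τ.im) {n : WithTop ℕ∞} : ContDiff ℂ n (theta3 τ) :=
  (differentiable_theta3 hτ').contDiff

lemma conj_eq_neg {τ : ℂ} (hτ : τ.re = 0) : conj τ = -τ := by
  apply Complex.ext <;> simp [hτ]

lemma conj_exp_pi {τ : ℂ} (hτ : τ.re = 0) :
    conj (cexp (Real.pi * I * τ)) = cexp (Real.pi * I * τ) := by
  simp [← Complex.exp_conj, conj_eq_neg hτ]

lemma conj_theta3 {τ : ℂ} (hτ : τ.re = 0) (z : ℂ) :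
    conj (theta3 τ z) = theta3 τ (conj z) := by
  simp only [theta3, map_mul, conj_qPoch, conj_nome hτ, map_neg, conj_exp_pi hτ]
  simp only [← Complex.exp_conj, map_neg, map_mul, map_ofNat, conj_ofReal, conj_I]
  ring_nf

/-- On the real line the two `z`-dependent factors are complex conjugates, so their product is a
squared modulus. -/
lemma theta3_pos_of_im {τ : ℂ} (hτ : τ.re = 0) (hτ' : 0 < τ.im) {z : ℂ} (hz : z.im = 0) :
    0 < theta3 τ z := by
  have h0 : theta3 τ z ≠ 0 := theta3_ne_zero_of_im hτ hτ' (by simpa [hz] using hτ')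
  have hc : conj z = z := Complex.conj_eq_iff_im.mpr hz
  have h1 : qPoch (-(cexp (Real.pi * I * τ) * cexp (-(2 * Real.pi * I * z)))) (nome τ) =
      conj (qPoch (-(cexp (Real.pi * I * τ) * cexp (2 * Real.pi * I * z))) (nome τ)) := by
    rw [conj_qPoch, conj_nome hτ, map_neg, map_mul, conj_exp_pi hτ, ← Complex.exp_conj]
    simp only [map_mul, map_ofNat, conj_ofReal, conj_I, hc]
    ring_nf
  rw [theta3, h1, mul_assoc, Complex.mul_conj] at h0 ⊢
  refine mul_pos (qPoch_nome_pos hτ hτ') ?_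
  rw [Complex.zero_lt_real]
  refine lt_of_le_of_ne (Complex.normSq_nonneg _) fun h => h0 ?_
  rw [← h]; simp

/-- On the imaginary axis both exponentials are positive reals, so every factor has the form `1 + r`
with `r > 0`. -/
lemma theta3_pos_of_re {τ : ℂ} (hτ : τ.re = 0) (hτ' : 0 < τ.im) {z : ℂ} (hz : z.re = 0) :
    0 < theta3 τ z := by
  have hp := norm_nome_lt_one hτ'
  have key : ∀ w : ℂ, w.re = 0 →
      0 < qPoch (-(cexp (Real.pi * I * τ) * cexp (2 * Real.pi * I * w))) (nome τ) := by
    intro w hw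
    have h2 : -(cexp (Real.pi * I * τ) * cexp (2 * Real.pi * I * w)) =
        (-(Real.exp (-(Real.pi * τ.im)) * Real.exp (-(2 * Real.pi * w.im))) : ℝ) := by
      obtain ⟨s, rfl⟩ : ∃ t : ℝ, w = t * I := ⟨w.im, by apply Complex.ext <;> simp [hw]⟩
      obtain ⟨t, rfl⟩ : ∃ t : ℝ, τ = t * I := ⟨τ.im, by apply Complex.ext <;> simp [hτ]⟩
      push_cast
      simp only [mul_im, ofReal_re, I_im, ofReal_im, I_re, mul_one, mul_zero, add_zero]
      congr 2 <;> congr 1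
      · linear_combination (Real.pi * t : ℂ) * I_mul_I
      · linear_combination (2 * Real.pi * s : ℂ) * I_mul_I
    rw [h2]
    rw [nome_eq_ofReal hτ] at hp ⊢
    rw [norm_real, Real.norm_eq_abs] at hp
    refine qPoch_pos hp fun j => ?_
    have : 0 < Real.exp (-(Real.pi * τ.im)) * Real.exp (-(2 * Real.pi * w.im)) *
      Real.exp (-(2 * Real.pi * τ.im)) ^ j := by positivity
    linarith
  have h1 := key z hz
  have h2 := key (-z) (by simpa using hz)
  rw [mul_neg] at h2
  exact mul_pos (mul_pos (qPoch_nome_pos hτ hτ') h1) h2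

/-! ### Quotients with removable singularities -/

open Classical in
/-- The quotient `p (u, w) / q u`, extended over the simple zeros of `q` by l'Hôpital's rule. -/
def quotExt (p : ℂ × ℂ → ℂ) (q : ℂ → ℂ) (x : ℂ × ℂ) : ℂ :=
  if q x.1 = 0 then fderiv ℂ p x (1, 0) / deriv q x.1 else p x / q x.1

lemma quotExt_of_ne {p : ℂ × ℂ → ℂ} {q : ℂ → ℂ} {x : ℂ × ℂ} (h : q x.1 ≠ 0) :
    quotExt p q x = p x / q x.1 := if_neg h

/-- At a zero `a` of `q` two approaches are treated separately. Inside the line `u = a` the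
l'Hôpital value is continuous because `p` is `C¹`. Off that line, strict differentiability compares
`p` at `(u, w')` and at `(a, w')`, where `p` vanishes, so `p / (u - a)` converges even though `w'`
moves too. -/
lemma continuous_quotExt {p : ℂ × ℂ → ℂ} {q : ℂ → ℂ} (hp : ContDiff ℂ 1 p)
    (hq : Differentiable ℂ q) (hq' : ∀ a, q a = 0 → deriv q a ≠ 0)
    (hpq : ∀ a, q a = 0 → ∀ w, p (a, w) = 0) : Continuous (quotExt p q) := by
  rw [continuous_iff_continuousAt]
  rintro ⟨a, w⟩
  by_cases ha : q a = 0
  · rw [← continuousWithinAt_univ, ← Set.union_compl_self {x : ℂ × ℂ | x.1 = a}]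
    refine ContinuousWithinAt.union ?_ ?_
    · have h1 : Continuous fun x : ℂ × ℂ => fderiv ℂ p x (1, 0) / deriv q a :=
        ((hp.continuous_fderiv (by simp)).clm_apply continuous_const).div_const _
      refine h1.continuousWithinAt.congr (fun x hx => ?_) ?_
      · have hx : x.1 = a := hx
        simp [quotExt, hx, ha]
      · simp [quotExt, ha]
    · set l := 𝓝[{x : ℂ × ℂ | x.1 = a}ᶜ] (a, w) with hl
      have hne : ∀ᶠ x in l, x.1 ≠ a := eventually_mem_nhdsWithin
      have hl1 : Tendsto (fun x : ℂ × ℂ => x.1) l (𝓝[≠] a) :=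
        tendsto_nhdsWithin_iff.mpr
          ⟨(continuous_fst.tendsto (a, w)).mono_left nhdsWithin_le_nhds, hne⟩
      set L := fderiv ℂ p (a, w)
      have hs : HasStrictFDerivAt p L (a, w) := hp.contDiffAt.hasStrictFDerivAt (by simp)
      have hc : Tendsto (fun x : ℂ × ℂ => (x, (a, x.2))) l (𝓝 ((a, w), (a, w))) := by
        have : Continuous fun x : ℂ × ℂ => (x, (a, x.2)) := by fun_prop
        exact (this.tendsto (a, w)).mono_left nhdsWithin_le_nhds
      have ho := (hs.isLittleO.comp_tendsto hc)
      have ho2 : (fun x : ℂ × ℂ => p x - (x.1 - a) * L (1, 0)) =o[l] fun x => x.1 - a := by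
        refine (ho.congr_left fun x => ?_).trans_isBigO (Asymptotics.isBigO_of_le _ fun x => ?_)
        · have : x - (a, x.2) = (x.1 - a) • ((1, 0) : ℂ × ℂ) := by ext <;> simp
          simp only [Function.comp_apply, this, map_smul, smul_eq_mul, hpq a ha, sub_zero]
        · simp [Prod.norm_def]
      have h1 : Tendsto (fun x : ℂ × ℂ => p x / (x.1 - a)) l (𝓝 (L (1, 0))) := by
        have := ho2.tendsto_div_nhds_zero.add_const (L (1, 0))
        rw [zero_add] at this
        refine this.congr' ?_
        filter_upwards [hne] with x hx
        have : x.1 - a ≠ 0 := sub_ne_zero.mpr hx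
        field_simp
        ring
      have h2 : Tendsto (fun x : ℂ × ℂ => q x.1 / (x.1 - a)) l (𝓝 (deriv q a)) := by
        have := (hasDerivAt_iff_tendsto_slope.mp (hq a).hasDerivAt).comp hl1
        refine this.congr fun x => ?_
        simp [slope_def_field, ha]
      have hqne : ∀ᶠ x in l, q x.1 ≠ 0 := by
        have := (hq a).hasDerivAt.eventually_ne (c := 0) (hq' a ha)
        exact hl1.eventually this
      have h3 := h1.div h2 (hq' a ha)
      have h4 : quotExt p q (a, w) = L (1, 0) / deriv q a := by simp [quotExt, ha, L]
      rw [ContinuousWithinAt, h4]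
      refine h3.congr' ?_
      filter_upwards [hne, hqne] with x hx hx'
      have : x.1 - a ≠ 0 := sub_ne_zero.mpr hx
      rw [quotExt_of_ne hx']
      simp only [Pi.div_apply]
      field_simp
  · have h1 : ContinuousAt (fun x : ℂ × ℂ => p x / q x.1) (a, w) :=
      hp.continuous.continuousAt.div (by have := hq.continuous; fun_prop) ha
    refine h1.congr ?_
    have : ∀ᶠ x : ℂ × ℂ in 𝓝 (a, w), q x.1 ≠ 0 :=
      ((hq.continuous.comp continuous_fst).continuousAt (x := (a, w))).eventually_ne ha
    filter_upwards [this] with x hx using (quotExt_of_ne hx).symm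

/-- An entire function that vanishes at the zeros of `q`, all of which are simple, is a multiple
of `q`. -/
lemma exists_eq_mul_of_zeros {f q : ℂ → ℂ} (hf : Differentiable ℂ f) (hq : Differentiable ℂ q)
    (hq' : ∀ a, q a = 0 → deriv q a ≠ 0) (hfq : ∀ a, q a = 0 → f a = 0) :
    ∃ E : ℂ → ℂ, Differentiable ℂ E ∧ ∀ u, f u = E u * q u := by
  have hp : ContDiff ℂ 1 fun x : ℂ × ℂ => f x.1 := hf.contDiff.comp contDiff_fst
  have hc := continuous_quotExt hp hq hq' fun a ha _ => hfq a ha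
  have hE : ∀ u, q u ≠ 0 → quotExt (fun x => f x.1) q (u, 0) = f u / q u :=
    fun u hu => quotExt_of_ne hu
  have hcE : Continuous fun u => quotExt (fun x => f x.1) q (u, 0) := by fun_prop
  have hdiff : ∀ u, q u ≠ 0 →
      DifferentiableAt ℂ (fun u => quotExt (fun x => f x.1) q (u, 0)) u := fun u hu => by
    refine ((hf u).div (hq u) hu).congr_of_eventuallyEq ?_
    filter_upwards [hq.continuous.continuousAt.eventually_ne hu] with z hz using hE z hz
  refine ⟨fun u => quotExt (fun x => f x.1) q (u, 0), fun a => ?_, fun u => ?_⟩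
  · by_cases ha : q a = 0
    · have h := (hq a).hasDerivAt.eventually_ne (c := 0) (hq' a ha)
      rw [eventually_nhdsWithin_iff] at h
      -- Zeros of `q` are isolated and the extended quotient is continuous there, so the singularity
      -- is removable.
      have h2 := (Complex.differentiableOn_compl_singleton_and_continuousAt_iff h).mp
        ⟨fun z hz => (hdiff z (hz.1 hz.2)).differentiableWithinAt, hcE.continuousAt⟩
      exact h2.differentiableAt h
    · exact hdiff a ha
  · by_cases hu : q u = 0
    · rw [hfq u hu, hu, mul_zero]
    · simp only [hE u hu]; field_simp

lemma isBounded_range_of_doubly_periodic {τ : ℂ} (hτ : τ.re = 0) (hτ' : 0 < τ.im) {E : ℂ → ℂ}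
    (hE : Continuous E) (h1 : ∀ x, E (x + 1) = E x) (h2 : ∀ x, E (x + τ) = E x) :
    Bornology.IsBounded (Set.range E) := by
  have hK : IsCompact (E '' ((fun x : ℝ × ℝ => (x.1 : ℂ) + x.2 * τ) ''
      (Set.Icc (0 : ℝ) 1 ×ˢ Set.Icc (0 : ℝ) 1))) :=
    ((isCompact_Icc.prod isCompact_Icc).image (by fun_prop)).image hE
  refine hK.isBounded.subset ?_
  rintro _ ⟨x, rfl⟩
  refine ⟨x + (-⌊x.re⌋ + -⌊x.im / τ.im⌋ * τ), ⟨(Int.fract x.re, Int.fract (x.im / τ.im)),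
    ⟨⟨Int.fract_nonneg _, (Int.fract_lt_one _).le⟩, Int.fract_nonneg _, (Int.fract_lt_one _).le⟩,
    ?_⟩, ?_⟩
  · apply Complex.ext
    · have := Int.self_sub_floor x.re
      simp [hτ]; linarith
    · have := div_mul_cancel₀ x.im hτ'.ne'
      simp only [add_im, ofReal_im, mul_im, ofReal_re, neg_im, intCast_im, neg_re, intCast_re]
      rw [← Int.self_sub_floor]
      linear_combination this
  · have hl : -(⌊x.re⌋ : ℂ) + -⌊x.im / τ.im⌋ * τ ∈ lattice τ :=
      mem_lattice.mpr ⟨-⌊x.re⌋, -⌊x.im / τ.im⌋, by push_cast; ring⟩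
    exact (lattice_induction (S := fun y => E y = E x) (fun y => by rw [h1]) (fun y => by rw [h2])
      hl x).mpr rfl

/-- Two entire functions with the same quasi-periods are proportional if one vanishes at the
zeros of the other, all of which are simple. -/
lemma exists_eq_const_mul {τ : ℂ} (hτ : τ.re = 0) (hτ' : 0 < τ.im) {f q m : ℂ → ℂ}
    (hf : Differentiable ℂ f) (hq : Differentiable ℂ q)
    (hq' : ∀ a, q a = 0 → deriv q a ≠ 0) (hfq : ∀ a, q a = 0 → f a = 0)
    (hd : Dense {x | q x ≠ 0}) (hm : ∀ x, m x ≠ 0) (hf1 : ∀ x, f (x + 1) = f x)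
    (hq1 : ∀ x, q (x + 1) = q x) (hfm : ∀ x, f (x + τ) = m x * f x)
    (hqm : ∀ x, q (x + τ) = m x * q x) : ∃ c, ∀ u, f u = c * q u := by
  -- The quotient `E` is entire; its periodicity holds off the zeros of `q` and extends by density.
  -- Double periodicity bounds it, and Liouville makes it constant.
  obtain ⟨E, hE, hfE⟩ := exists_eq_mul_of_zeros hf hq hq' hfq
  have hEc := hE.continuous
  have h1 : ∀ x, E (x + 1) = E x := by
    refine fun x => congrFun (Continuous.ext_on hd (f := fun x => E (x + 1)) (by fun_prop) hEc ?_) x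
    intro x hx
    have := hf1 x
    rw [hfE, hfE, hq1] at this
    exact mul_right_cancel₀ hx this
  have h2 : ∀ x, E (x + τ) = E x := by
    refine fun x => congrFun (Continuous.ext_on hd (f := fun x => E (x + τ)) (by fun_prop) hEc ?_) x
    intro x hx
    have := hfm x
    rw [hfE, hfE x, hqm] at this
    exact mul_right_cancel₀ (mul_ne_zero (hm x) hx) (by linear_combination this)
  refine ⟨E 0, fun u => ?_⟩
  rw [hfE, hE.apply_eq_apply_of_bounded (isBounded_range_of_doubly_periodic hτ hτ' hEc h1 h2) u 0]

/-! ### The addition formula -/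

/-- The quasi-periodicity factor `e^{-2πi(2u+τ)}`. -/
def mult (τ u : ℂ) : ℂ := cexp (-(2 * Real.pi * I * (2 * u + τ)))

lemma mult_ne_zero (τ u : ℂ) : mult τ u ≠ 0 := Complex.exp_ne_zero _

/-- The product `θ(v ± u)`. -/
def thetaPair (τ v u : ℂ) : ℂ := theta τ (v + u) * theta τ (v - u)

/-- The product `θ₃(y ± u)`. -/
def theta3Pair (τ y u : ℂ) : ℂ := theta3 τ (y + u) * theta3 τ (y - u)

lemma differentiable_thetaPair {τ : ℂ} (hτ' : 0 < τ.im) (v : ℂ) :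
    Differentiable ℂ (thetaPair τ v) := by
  unfold thetaPair
  fun_prop (disch := assumption)

lemma thetaPair_add_one (τ v u : ℂ) : thetaPair τ v (u + 1) = thetaPair τ v u := by
  have h := theta_add_one τ (v - (u + 1))
  rw [show v - (u + 1) + 1 = v - u by ring] at h
  rw [thetaPair, thetaPair, ← add_assoc, theta_add_one, h]
  ring

lemma theta3Pair_add_one (τ y u : ℂ) : theta3Pair τ y (u + 1) = theta3Pair τ y u := by
  have h := theta3_add_one τ (y - (u + 1))
  rw [show y - (u + 1) + 1 = y - u by ring] at h
  rw [theta3Pair, theta3Pair, ← add_assoc, theta3_add_one, h]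

lemma exp_mul_exp_eq_mult (τ v u : ℂ) :
    (cexp (-(Real.pi * I * τ)) * cexp (-(2 * Real.pi * I * (v + u)))) *
      (cexp (-(Real.pi * I * τ)) * cexp (-(2 * Real.pi * I * (u - v)))) = mult τ u := by
  rw [mult, ← Complex.exp_add, ← Complex.exp_add, ← Complex.exp_add]
  ring_nf

lemma thetaPair_add_tau {τ : ℂ} (hτ : τ.re = 0) (hτ' : 0 < τ.im) (v u : ℂ) :
    thetaPair τ v (u + τ) = mult τ u * thetaPair τ v u := by
  rw [thetaPair, thetaPair, ← add_assoc, theta_add_tau hτ hτ',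
    show v - (u + τ) = -(u - v + τ) by ring, theta_neg hτ', theta_add_tau hτ hτ',
    show u - v = -(v - u) by ring, theta_neg hτ', ← exp_mul_exp_eq_mult τ v u]
  ring_nf

lemma theta3Pair_add_tau {τ : ℂ} (hτ : τ.re = 0) (hτ' : 0 < τ.im) (y u : ℂ) :
    theta3Pair τ y (u + τ) = mult τ u * theta3Pair τ y u := by
  rw [theta3Pair, theta3Pair, ← add_assoc, theta3_add_tau hτ hτ',
    show y - (u + τ) = -(u - y + τ) by ring, theta3_neg, theta3_add_tau hτ hτ',
    ← theta3_neg τ (y - u), show -(y - u) = u - y by ring, ← exp_mul_exp_eq_mult τ y u]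
  ring

lemma theta3Pair_neg (τ y u : ℂ) : theta3Pair τ y (-u) = theta3Pair τ y u := by
  rw [theta3Pair, theta3Pair, sub_neg_eq_add, ← sub_eq_add_neg, mul_comm]

lemma thetaPair_eq_zero_iff {τ : ℂ} (hτ : τ.re = 0) (hτ' : 0 < τ.im) {v u : ℂ} :
    thetaPair τ v u = 0 ↔ v + u ∈ lattice τ ∨ v - u ∈ lattice τ := by
  rw [thetaPair, mul_eq_zero, theta_eq_zero_iff hτ hτ', theta_eq_zero_iff hτ hτ']

lemma hasDerivAt_thetaPair {τ : ℂ} (hτ' : 0 < τ.im) (v u : ℂ) :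
    HasDerivAt (thetaPair τ v)
      (deriv (theta τ) (v + u) * theta τ (v - u) - theta τ (v + u) * deriv (theta τ) (v - u)) u := by
  have h := differentiable_theta hτ'
  have h1 := (h (v + u)).hasDerivAt.comp_const_add v u
  have h2 := (h (v - u)).hasDerivAt.comp_const_sub v u
  exact (h1.mul h2).congr_deriv (by ring)

/-- If `v + u` and `v - u` were both lattice points, so would be their sum `2v`. Hence exactly one
factor vanishes, and it does so simply. -/
lemma deriv_thetaPair_ne_zero {τ : ℂ} (hτ : τ.re = 0) (hτ' : 0 < τ.im) {v : ℂ}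
    (hv : 2 * v ∉ lattice τ) {u : ℂ} (hu : thetaPair τ v u = 0) :
    deriv (thetaPair τ v) u ≠ 0 := by
  rw [(hasDerivAt_thetaPair hτ' v u).deriv]
  have hne : ¬ (v + u ∈ lattice τ ∧ v - u ∈ lattice τ) := fun h => hv (by
    have := add_mem h.1 h.2
    rwa [show v + u + (v - u) = 2 * v by ring] at this)
  rcases (thetaPair_eq_zero_iff hτ hτ').mp hu with h | h
  · have h0 := (theta_eq_zero_iff hτ hτ').mpr h
    have h1 : theta τ (v - u) ≠ 0 := fun h' => hne ⟨h, (theta_eq_zero_iff hτ hτ').mp h'⟩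
    simpa [h0] using ⟨deriv_theta_ne_zero hτ hτ' h, h1⟩
  · have h0 := (theta_eq_zero_iff hτ hτ').mpr h
    have h1 : theta τ (v + u) ≠ 0 := fun h' => hne ⟨(theta_eq_zero_iff hτ hτ').mp h', h⟩
    simpa [h0] using ⟨h1, deriv_theta_ne_zero hτ hτ' h⟩

lemma countable_zeros_thetaPair {τ : ℂ} (hτ : τ.re = 0) (hτ' : 0 < τ.im) (v : ℂ) :
    {u | thetaPair τ v u = 0}.Countable := by
  refine (((countable_lattice τ).image fun l => l - v).union
    ((countable_lattice τ).image fun l => v - l)).mono fun u hu => ?_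
  rcases (thetaPair_eq_zero_iff hτ hτ').mp hu with h | h
  · exact Or.inl ⟨_, h, by ring⟩
  · exact Or.inr ⟨_, h, by ring⟩

lemma dense_thetaPair_ne_zero {τ : ℂ} (hτ : τ.re = 0) (hτ' : 0 < τ.im) (v : ℂ) :
    Dense {u | thetaPair τ v u ≠ 0} :=
  (countable_zeros_thetaPair hτ hτ' v).dense_compl ℝ

/-- A property that is invariant under lattice translations and holds at `±v` holds at all zeros
of `θ(v ± u)`. -/
lemma of_thetaPair_eq_zero {τ : ℂ} (hτ : τ.re = 0) (hτ' : 0 < τ.im) {v : ℂ} {S : ℂ → Prop}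
    (h1 : ∀ x, S (x + 1) ↔ S x) (h2 : ∀ x, S (x + τ) ↔ S x) (hv : S v) (hv' : S (-v)) {u : ℂ}
    (hu : thetaPair τ v u = 0) : S u := by
  rcases (thetaPair_eq_zero_iff hτ hτ').mp hu with h | h
  · have := (lattice_induction h1 h2 h (-v)).mpr hv'
    rwa [neg_add_cancel_left] at this
  · have := (lattice_induction h1 h2 (neg_mem h) v).mpr hv
    rwa [neg_sub, add_sub_cancel] at this

/-- This is the addition formula at the zero `u = x + 1/2 + τ/2` of `θ₃(x ± u)`; it fixes the
constant of proportionality in `theta_addition`. -/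
lemma theta3Pair_half_period {τ : ℂ} (hτ : τ.re = 0) (hτ' : 0 < τ.im) (x y v : ℂ) :
    theta3Pair τ x v * theta3Pair τ y (x + 1 / 2 + τ / 2) =
      theta τ (x + y) * theta τ (x - y) * thetaPair τ v (x + 1 / 2 + τ / 2) := by
  have h1 : theta τ (x - v + 1 / 2 + τ / 2) = -theta τ (v - (x + 1 / 2 + τ / 2)) := by
    rw [← theta_neg hτ']; ring_nf
  have h2 : theta τ (y + (x + 1 / 2 + τ / 2) + 1 / 2 + τ / 2) =
      cexp (-(Real.pi * I * τ)) * cexp (-(2 * Real.pi * I * (x + y))) * theta τ (x + y) := by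
    rw [show y + (x + 1 / 2 + τ / 2) + 1 / 2 + τ / 2 = x + y + τ + 1 by ring, theta_add_one,
      theta_add_tau hτ hτ']
    ring
  have h3 : theta τ (y - (x + 1 / 2 + τ / 2) + 1 / 2 + τ / 2) = -theta τ (x - y) := by
    rw [← theta_neg hτ']; ring_nf
  have h4 : cexp (Real.pi * I * τ / 4) * cexp (Real.pi * I * (x + v)) *
      (cexp (Real.pi * I * τ / 4) * cexp (Real.pi * I * (x - v))) *
      (cexp (Real.pi * I * τ / 4) * cexp (Real.pi * I * (y + (x + 1 / 2 + τ / 2)))) *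
      (cexp (Real.pi * I * τ / 4) * cexp (Real.pi * I * (y - (x + 1 / 2 + τ / 2)))) *
      (cexp (-(Real.pi * I * τ)) * cexp (-(2 * Real.pi * I * (x + y)))) = 1 := by
    simp only [← Complex.exp_add]
    rw [← Complex.exp_zero]
    ring_nf
  rw [theta3Pair, theta3Pair, thetaPair, theta3_eq hτ (x + v), theta3_eq hτ (x - v),
    theta3_eq hτ (y + _), theta3_eq hτ (y - _), h1, h2, h3,
    show x + v + 1 / 2 + τ / 2 = v + (x + 1 / 2 + τ / 2) by ring]
  linear_combination (theta τ (v + (x + 1 / 2 + τ / 2)) * theta τ (v - (x + 1 / 2 + τ / 2)) *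
    theta τ (x + y) * theta τ (x - y)) * h4

/-- Weierstrass' addition formula. -/
lemma theta_addition {τ : ℂ} (hτ : τ.re = 0) (hτ' : 0 < τ.im) {v : ℂ} (hv : 2 * v ∉ lattice τ)
    (x y u : ℂ) :
    theta3Pair τ x v * theta3Pair τ y u - theta3Pair τ x u * theta3Pair τ y v =
      theta τ (x + y) * theta τ (x - y) * thetaPair τ v u := by
  set c : ℂ := 1 / 2 + τ / 2 with hc
  have hdense : Dense {x | thetaPair τ v (x + c) ≠ 0} :=
    (dense_thetaPair_ne_zero hτ hτ' v).preimage (Homeomorph.addRight c).isOpenMap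
  refine congrFun (Continuous.ext_on hdense (f := fun x => theta3Pair τ x v * theta3Pair τ y u -
    theta3Pair τ x u * theta3Pair τ y v)
    (g := fun x => theta τ (x + y) * theta τ (x - y) * thetaPair τ v u)
    (by unfold theta3Pair; fun_prop (disch := assumption))
    (by fun_prop (disch := assumption)) fun x hx => ?_) x
  -- As functions of `u`, both sides have the multiplier `mult`, and the left side vanishes at `u =
  -- ±v`, hence at all zeros of `θ(v ± u)`. It remains to find `κ`, by evaluation at `u = x + c`;
  -- the density argument in `x` keeps the divisor `θ(v ± (x + c))` nonzero.
  obtain ⟨κ, hκ⟩ := exists_eq_const_mul hτ hτ' (m := mult τ)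
    (f := fun u => theta3Pair τ x v * theta3Pair τ y u - theta3Pair τ x u * theta3Pair τ y v)
    (by unfold theta3Pair; fun_prop (disch := assumption)) (differentiable_thetaPair hτ' v)
    (fun a ha => deriv_thetaPair_ne_zero hτ hτ' hv ha)
    (fun a ha => by
      refine of_thetaPair_eq_zero hτ hτ' (S := fun u => theta3Pair τ x v * theta3Pair τ y u -
        theta3Pair τ x u * theta3Pair τ y v = 0) (fun u => ?_) (fun u => ?_) ?_ ?_ ha
      · simp only [theta3Pair_add_one]
      · simp only [theta3Pair_add_tau hτ hτ']
        rw [show theta3Pair τ x v * (mult τ u * theta3Pair τ y u) - mult τ u * theta3Pair τ x u *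
          theta3Pair τ y v = mult τ u * (theta3Pair τ x v * theta3Pair τ y u - theta3Pair τ x u *
          theta3Pair τ y v) by ring, mul_eq_zero, or_iff_right (mult_ne_zero τ u)]
      · ring
      · simp only [theta3Pair_neg]; ring)
    (dense_thetaPair_ne_zero hτ hτ' v) (mult_ne_zero τ)
    (fun u => by simp only [theta3Pair_add_one]) (thetaPair_add_one τ v)
    (fun u => by simp only [theta3Pair_add_tau hτ hτ']; ring) (thetaPair_add_tau hτ hτ' v)
  have h0 : theta3Pair τ x (x + c) = 0 := by
    have : theta3 τ (x - (x + c)) = 0 := by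
      rw [theta3_eq_zero_iff hτ hτ']
      convert zero_mem (lattice τ) using 1
      rw [hc]; ring
    rw [theta3Pair, this, mul_zero]
  have h1 := hκ (x + c)
  have h2 := theta3Pair_half_period hτ hτ' x y v
  rw [show x + 1 / 2 + τ / 2 = x + c by rw [hc]; ring] at h2
  simp only [h0, zero_mul, sub_zero, h2] at h1
  have h3 := mul_right_cancel₀ hx h1
  simp only [hκ u, h3]

/-! ### Products over the symmetric progression `1 - n, 3 - n, …, n - 1` -/

lemma sum_range_two_mul_sub (n : ℕ) : ∑ k ∈ Finset.range n, (2 * (k : ℂ) - n + 1) = 0 := by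
  have h : ∀ m : ℂ, ∑ k ∈ Finset.range n, (2 * (k : ℂ) - m + 1) = n * (n - m) := fun m => by
    induction n with
    | zero => simp
    | succ n ih => rw [Finset.sum_range_succ, ih]; push_cast; ring
  rw [h, sub_self, mul_zero]

lemma prod_range_symm_neg (g : ℂ → ℂ) (n : ℕ) :
    ∏ k ∈ Finset.range n, g (-(2 * (k : ℂ) - n + 1)) =
      ∏ k ∈ Finset.range n, g (2 * (k : ℂ) - n + 1) := by
  rw [← Finset.prod_range_reflect]
  refine Finset.prod_congr rfl fun k hk => ?_
  have : k + 1 ≤ n := Finset.mem_range.mp hk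
  rw [show n - 1 - k = n - (k + 1) by omega, Nat.cast_sub this]
  push_cast
  ring_nf

/-- Opposite points of the progression carry conjugate factors. The induction strips the outermost
pair, which contributes a squared modulus; for odd `n` the central factor `g 0` is left. -/
lemma prod_range_symm_pos {g : ℂ → ℂ} (n : ℕ) (h0 : 0 < g 0)
    (hg : ∀ r : ℝ, conj (g r) = g (-r)) (hne : ∀ r : ℝ, |r| ≤ n - 1 → g r ≠ 0) :
    0 < ∏ k ∈ Finset.range n, g (2 * (k : ℂ) - n + 1) := by
  induction n using Nat.twoStepInduction with
  | zero => simp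
  | one => simpa using h0
  | more n ih _ =>
    rw [Finset.prod_range_succ, Finset.prod_range_succ']
    have h1 : ∀ k : ℕ, (2 * ((k + 1 : ℕ) : ℂ) - (n + 2 : ℕ) + 1) = 2 * (k : ℂ) - n + 1 :=
      fun k => by push_cast; ring
    have h2 : (2 * ((n + 1 : ℕ) : ℂ) - (n + 2 : ℕ) + 1) = ((n + 1 : ℝ) : ℂ) := by push_cast; ring
    have h3 : (2 * ((0 : ℕ) : ℂ) - (n + 2 : ℕ) + 1) = -((n + 1 : ℝ) : ℂ) := by push_cast; ring
    rw [h2, h3, ← hg]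
    simp only [h1]
    rw [mul_assoc, mul_comm (conj _), Complex.mul_conj]
    refine mul_pos (ih fun r hr => hne r (hr.trans ?_)) ?_
    · push_cast; linarith
    · rw [Complex.zero_lt_real, Complex.normSq_pos]
      refine hne _ ?_
      rw [abs_of_pos (by positivity)]; push_cast; linarith

/-! ### The theta products of the kernel and of the weight -/

/-- The product `∏_{k < n} θ₃(w ± v + (2k - n + 1)η)`. -/
def thetaProd (τ η : ℂ) (n : ℕ) (v w : ℂ) : ℂ :=
  ∏ k ∈ Finset.range n, theta3Pair τ (w + (2 * (k : ℂ) - n + 1) * η) v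

lemma thetaProd_neg (τ η : ℂ) (n : ℕ) (v w : ℂ) : thetaProd τ η n (-v) w = thetaProd τ η n v w := by
  simp only [thetaProd, theta3Pair_neg]

lemma thetaProd_add_one (τ η : ℂ) (n : ℕ) (v w : ℂ) :
    thetaProd τ η n (v + 1) w = thetaProd τ η n v w := by
  simp only [thetaProd, theta3Pair_add_one]

lemma thetaProd_add_tau {τ : ℂ} (hτ : τ.re = 0) (hτ' : 0 < τ.im) (η : ℂ) (n : ℕ) (v w : ℂ) :
    thetaProd τ η n (v + τ) w = mult τ v ^ n * thetaProd τ η n v w := by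
  simp only [thetaProd, theta3Pair_add_tau hτ hτ', Finset.prod_mul_distrib, Finset.prod_const,
    Finset.card_range]

/-- Evenness of `θ₃` together with the symmetry of the progression. It transfers quasi-periodicity
from one argument to the other. -/
lemma thetaProd_comm (τ η : ℂ) (n : ℕ) (v w : ℂ) : thetaProd τ η n v w = thetaProd τ η n w v := by
  simp only [thetaProd, theta3Pair, Finset.prod_mul_distrib]
  congr 1
  · refine Finset.prod_congr rfl fun k _ => ?_
    ring_nf
  · rw [← prod_range_symm_neg (fun r => theta3 τ (v + r * η - w))]
    refine Finset.prod_congr rfl fun k _ => ?_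
    rw [← theta3_neg]
    ring_nf

lemma thetaProd_neg_step (τ η : ℂ) (n : ℕ) (v w : ℂ) :
    thetaProd τ (-η) n v w = thetaProd τ η n v w := by
  simp only [thetaProd]
  rw [← prod_range_symm_neg (fun r => theta3Pair τ (w + r * η) v)]
  refine Finset.prod_congr rfl fun k _ => ?_
  ring_nf

lemma thetaProd_zero_step (τ : ℂ) (n : ℕ) (v w : ℂ) :
    thetaProd τ 0 n v w = theta3Pair τ w v ^ n := by
  simp [thetaProd]

/-- For imaginary `η` conjugation reverses the step, and the symmetric progression does not notice.
-/
lemma conj_thetaProd {τ η : ℂ} (hτ : τ.re = 0) (hη : η.im = 0 ∨ η.re = 0) (n : ℕ) (v w : ℂ) :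
    conj (thetaProd τ η n v w) = thetaProd τ η n (conj v) (conj w) := by
  have h : conj (thetaProd τ η n v w) = thetaProd τ (conj η) n (conj v) (conj w) := by
    simp only [thetaProd, theta3Pair, map_prod, map_mul, conj_theta3 hτ, map_add, map_sub,
      map_ofNat, map_natCast, map_one]
  rcases hη with hη | hη
  · rw [h, Complex.conj_eq_iff_im.mpr hη]
  · rw [h, conj_eq_neg hη, thetaProd_neg_step]

@[fun_prop]
lemma contDiff_thetaProd {τ : ℂ} (hτ' : 0 < τ.im) (η : ℂ) (n : ℕ) {m : WithTop ℕ∞} :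
    ContDiff ℂ m fun x : ℂ × ℂ => thetaProd τ η n x.1 x.2 := by
  unfold thetaProd theta3Pair
  refine contDiff_prod fun k _ => ?_
  have h1 : ContDiff ℂ m fun x : ℂ × ℂ => x.2 + (2 * (k : ℂ) - n + 1) * η + x.1 := by fun_prop
  have h2 : ContDiff ℂ m fun x : ℂ × ℂ => x.2 + (2 * (k : ℂ) - n + 1) * η - x.1 := by fun_prop
  exact ((contDiff_theta3 hτ').comp h1).mul ((contDiff_theta3 hτ').comp h2)

/-- Shifting the progression of length `n + 1` by `±η` aligns it with that of length `n` except for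
one end factor. These end factors are what the addition formula combines. -/
lemma thetaProd_succ_add (τ η : ℂ) (n : ℕ) (v w : ℂ) :
    thetaProd τ η (n + 1) v (w + η) =
      thetaProd τ η n v w * theta3Pair τ (w + (n + 1) * η) v := by
  rw [thetaProd, Finset.prod_range_succ, thetaProd]
  push_cast
  congr 1
  · refine Finset.prod_congr rfl fun k _ => ?_
    ring_nf
  · ring_nf

lemma thetaProd_succ_sub (τ η : ℂ) (n : ℕ) (v w : ℂ) :
    thetaProd τ η (n + 1) v (w - η) =
      thetaProd τ η n v w * theta3Pair τ (w - (n + 1) * η) v := by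
  rw [thetaProd, Finset.prod_range_succ', thetaProd]
  push_cast
  congr 1
  · refine Finset.prod_congr rfl fun k _ => ?_
    ring_nf
  · ring_nf

lemma thetaProd_add_two (τ η : ℂ) (n : ℕ) (v w : ℂ) :
    thetaProd τ η (n + 2) v w =
      thetaProd τ η n v w * theta3Pair τ (w + (n + 1) * η) v *
        theta3Pair τ (w - (n + 1) * η) v := by
  rw [thetaProd, Finset.prod_range_succ, Finset.prod_range_succ', thetaProd, mul_right_comm]
  push_cast
  congr 1
  · congr 1
    · refine Finset.prod_congr rfl fun k _ => ?_
      ring_nf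
    · ring_nf
  · ring_nf

/-- Each pair of shifted thetas contributes `e^{-2πi(u + rη)}`. The shifts `r` sum to zero, so `η`
drops out and the prefactor cancels the dependence on `u`. -/
lemma exp_mul_prod_theta {τ : ℂ} (hτ : τ.re = 0) (η : ℂ) (n : ℕ) (u v : ℂ) :
    cexp (2 * Real.pi * I * u * n) * ∏ k ∈ Finset.range n,
      (theta τ (u + v + (2 * (k : ℂ) - n + 1) * η + 1 / 2 + τ / 2) *
        theta τ (u - v + (2 * (k : ℂ) - n + 1) * η + 1 / 2 + τ / 2)) =
      cexp (-(Real.pi * I * τ / 2 * n)) * thetaProd τ η n v u := by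
  have h : ∀ r : ℂ, theta τ (u + v + r * η + 1 / 2 + τ / 2) *
      theta τ (u - v + r * η + 1 / 2 + τ / 2) =
      cexp (-(Real.pi * I * τ / 2) - 2 * Real.pi * I * u + r * (-(2 * Real.pi * I * η))) *
        theta3Pair τ (u + r * η) v := fun r => by
    rw [theta_shift hτ, theta_shift hτ, theta3Pair, show u + v + r * η = u + r * η + v by ring,
      show u - v + r * η = u + r * η - v by ring]
    have h2 : cexp (-(Real.pi * I * τ / 2) - 2 * Real.pi * I * u + r * (-(2 * Real.pi * I * η))) =
      cexp (-(Real.pi * I * τ / 4)) * cexp (-(Real.pi * I * (u + r * η + v))) *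
      (cexp (-(Real.pi * I * τ / 4)) * cexp (-(Real.pi * I * (u + r * η - v)))) := by
      simp only [← Complex.exp_add]
      ring_nf
    rw [h2]
    ring
  simp only [h]
  rw [Finset.prod_mul_distrib, ← Complex.exp_sum, Finset.sum_add_distrib, ← Finset.sum_mul,
    sum_range_two_mul_sub, ← mul_assoc, ← Complex.exp_add, thetaProd]
  simp only [Finset.sum_const, Finset.card_range, nsmul_eq_mul]
  ring_nf

lemma sklyaninKernel_eq {τ : ℂ} (hτ : τ.re = 0) (η : ℂ) (N : ℕ) (v u : ℂ) :
    sklyaninKernel τ η N v u =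
      cexp (-(Real.pi * I * τ / 2 * N)) * thetaProd τ η N (conj v) u := by
  rw [← exp_mul_prod_theta hτ, sklyaninKernel]

lemma weight_eq {τ : ℂ} (hτ : τ.re = 0) (η : ℂ) (N : ℕ) (u w : ℂ) :
    weight τ η N u w = cexp (Real.pi * I * τ / 2 * (N + 2)) * (theta τ (2 * u) * theta τ (2 * w)) /
      thetaProd τ η (N + 2) u w := by
  have h := exp_mul_prod_theta hτ η (N + 2) u w
  push_cast at h
  simp only [show ∀ k : ℂ, 2 * k - (N + 2) + 1 = 2 * k - N - 1 from fun k => by ring] at h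
  rw [weight, h, thetaProd_comm, Complex.exp_neg]
  have := Complex.exp_ne_zero (Real.pi * I * τ / 2 * (N + 2))
  field_simp

/-! ### Admissible steps -/

/-- The step `η` is real or imaginary and so small that the denominators of the weight do not
vanish. -/
def Admissible (τ η : ℂ) (N : ℕ) : Prop :=
  (η.im = 0 ∧ (N + 1) * ‖η‖ < 1 / 2) ∨ (η.re = 0 ∧ (N + 1) * ‖η‖ < τ.im / 2)

lemma admissible_of_mem {τ η : ℂ} {N : ℕ} (h : η ∈ realRange N ∪ imagRange τ N) :
    Admissible τ η N := by
  have hN : (0 : ℝ) < N + 1 := by positivity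
  rcases h with ⟨h1, h2⟩ | ⟨h1, h2⟩
  · left
    rw [lt_div_iff₀ (by positivity)] at h2
    exact ⟨h1, by linarith⟩
  · right
    rw [lt_div_iff₀ (by positivity)] at h2
    exact ⟨h1, by linarith⟩

lemma Admissible.im_or_re {τ η : ℂ} {N : ℕ} (h : Admissible τ η N) : η.im = 0 ∨ η.re = 0 :=
  h.imp And.left And.left

lemma norm_ofReal_mul_le {a : ℝ} {N : ℕ} (ha : |a| ≤ N + 1) (η : ℂ) :
    ‖(a : ℂ) * η‖ ≤ (N + 1) * ‖η‖ := by
  rw [norm_mul, norm_real, Real.norm_eq_abs]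
  gcongr

/-- The zeros of `θ₃` are the translates of `1/2 + τ/2`. If `z` and `η` lie on the same axis the
point stays on it; otherwise the bound on `η` keeps its displacement from the axis of `z` below half
a period. -/
lemma theta3_add_ne_zero {τ η : ℂ} {N : ℕ} (hτ : τ.re = 0) (hτ' : 0 < τ.im)
    (hη : Admissible τ η N) {z : ℂ} (hz : z.im = 0 ∨ z.re = 0) {a : ℝ} (ha : |a| ≤ N + 1) :
    theta3 τ (z + a * η) ≠ 0 := by
  have hn := norm_ofReal_mul_le ha η
  rcases hη with ⟨h1, h2⟩ | ⟨h1, h2⟩ <;> rcases hz with hz | hz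
  · refine theta3_ne_zero_of_im hτ hτ' ?_
    simpa [h1, hz] using hτ'
  · refine theta3_ne_zero_of_re hτ hτ' ?_
    rw [add_re, hz, zero_add]
    exact (Complex.abs_re_le_norm _).trans_lt (hn.trans_lt h2)
  · refine theta3_ne_zero_of_im hτ hτ' ?_
    rw [add_im, hz, zero_add]
    exact (Complex.abs_im_le_norm _).trans_lt (hn.trans_lt h2)
  · refine theta3_ne_zero_of_re hτ hτ' ?_
    simp [h1, hz]

lemma theta3Pair_ne_zero {τ η : ℂ} {N : ℕ} (hτ : τ.re = 0) (hτ' : 0 < τ.im)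
    (hη : Admissible τ η N) (u : ℂ) {a : ℝ} (ha : |a| ≤ N + 1) :
    theta3Pair τ (conj u + a * η) u ≠ 0 := by
  rw [theta3Pair, show conj u + a * η + u = (conj u + u) + a * η by ring,
    show conj u + a * η - u = (conj u - u) + a * η by ring]
  exact mul_ne_zero (theta3_add_ne_zero hτ hτ' hη (Or.inl (by simp)) ha)
    (theta3_add_ne_zero hτ hτ' hη (Or.inr (by simp)) ha)

/-- The shifts `t + 2k - n + 1` stay within `[-(N+1), N+1]`. The case needed later is `n = N + 1`,
`|t| ≤ 1`: the path from `ū - η` to `ū + η` meets no pole of the ratio. -/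
lemma thetaProd_ne_zero {τ η : ℂ} {N n : ℕ} (hτ : τ.re = 0) (hτ' : 0 < τ.im)
    (hη : Admissible τ η N) (u : ℂ) {t : ℝ} (ht : |t| + n ≤ N + 2) :
    thetaProd τ η n u (conj u + t * η) ≠ 0 := by
  refine Finset.prod_ne_zero_iff.mpr fun k hk => ?_
  have hk : (k : ℝ) + 1 ≤ n := by exact_mod_cast Finset.mem_range.mp hk
  have := theta3Pair_ne_zero hτ hτ' hη u (a := t + (2 * k - n + 1)) (by
    have h1 := abs_add_le t (2 * k - n + 1)
    have h2 : |(2 * k - n + 1 : ℝ)| ≤ n - 1 := by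
      have : (0 : ℝ) ≤ k := by positivity
      rw [abs_le]; constructor <;> linarith
    linarith)
  convert this using 2
  push_cast
  ring

lemma prod_theta3_pos {τ η : ℂ} {N : ℕ} (hτ : τ.re = 0) (hτ' : 0 < τ.im)
    (hη : Admissible τ η N) {z : ℂ} (hz : z.im = 0 ∨ z.re = 0) :
    0 < ∏ k ∈ Finset.range (N + 2), theta3 τ (z + (2 * (k : ℂ) - (N + 2 : ℕ) + 1) * η) := by
  have h0 : 0 < theta3 τ (z + 0 * η) := by
    rw [zero_mul, add_zero]
    exact hz.elim (theta3_pos_of_im hτ hτ') (theta3_pos_of_re hτ hτ')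
  have hne : ∀ r : ℝ, |r| ≤ (N + 2 : ℕ) - 1 → theta3 τ (z + r * η) ≠ 0 := fun r hr =>
    theta3_add_ne_zero hτ hτ' hη hz (hr.trans (by push_cast; linarith))
  have hre : ∀ k : ℕ, (2 * (k : ℂ) - (N + 2 : ℕ) + 1) = ((2 * k - (N + 2 : ℕ) + 1 : ℝ) : ℂ) :=
    fun k => by push_cast; ring
  rcases hη.im_or_re with h1 | h1 <;> rcases hz with hz | hz
  · refine Finset.prod_pos fun k _ => theta3_pos_of_im hτ hτ' ?_
    rw [hre]; simp [hz, h1]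
  · refine prod_range_symm_pos (g := fun r => theta3 τ (z + r * η)) _ h0 (fun r => ?_) hne
    rw [conj_theta3 hτ, ← theta3_neg]
    simp only [map_add, map_mul, conj_ofReal, conj_eq_neg hz, Complex.conj_eq_iff_im.mpr h1]
    ring_nf
  · refine prod_range_symm_pos (g := fun r => theta3 τ (z + r * η)) _ h0 (fun r => ?_) hne
    rw [conj_theta3 hτ]
    simp only [map_add, map_mul, conj_ofReal, conj_eq_neg h1, Complex.conj_eq_iff_im.mpr hz]
    ring_nf
  · refine Finset.prod_pos fun k _ => theta3_pos_of_re hτ hτ' ?_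
    rw [hre]; simp [hz, h1]

lemma thetaProd_pos {τ η : ℂ} {N : ℕ} (hτ : τ.re = 0) (hτ' : 0 < τ.im)
    (hη : Admissible τ η N) (u : ℂ) : 0 < thetaProd τ η (N + 2) u (conj u) := by
  have h1 := prod_theta3_pos hτ hτ' hη (z := conj u + u) (Or.inl (by simp))
  have h2 := prod_theta3_pos hτ hτ' hη (z := conj u - u) (Or.inr (by simp))
  have := mul_pos h1 h2
  rw [← Finset.prod_mul_distrib] at this
  convert this using 1
  refine Finset.prod_congr rfl fun k _ => ?_
  rw [theta3Pair]
  ring_nf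

/-- The weight is a positive multiple of `|θ(2u)|²`. -/
lemma weight_conj_eq {τ η : ℂ} {N : ℕ} (hτ : τ.re = 0) (hτ' : 0 < τ.im)
    (hη : Admissible τ η N) (u : ℂ) :
    ∃ r : ℝ, 0 < r ∧ weight τ η N u (conj u) = (r * ‖theta τ (2 * u)‖ ^ 2 : ℝ) := by
  have h1 := thetaProd_pos hτ hτ' hη u
  have h2 : cexp (Real.pi * I * τ / 2 * (N + 2)) =
      (Real.exp (-(Real.pi * τ.im / 2 * (N + 2))) : ℝ) := by
    obtain ⟨t, rfl⟩ : ∃ t : ℝ, τ = t * I := ⟨τ.im, by apply Complex.ext <;> simp [hτ]⟩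
    push_cast
    simp only [mul_im, ofReal_re, I_im, ofReal_im, I_re, mul_one, mul_zero, add_zero]
    congr 1
    linear_combination ((Real.pi : ℂ) * t / 2 * (N + 2)) * I_mul_I
  obtain ⟨s, hs, hs'⟩ : ∃ s : ℝ, 0 < s ∧ thetaProd τ η (N + 2) u (conj u) = s := by
    refine ⟨(thetaProd τ η (N + 2) u (conj u)).re, ?_, ?_⟩
    · exact (Complex.pos_iff.mp h1).1
    · apply Complex.ext <;> simp [← (Complex.pos_iff.mp h1).2]
  refine ⟨Real.exp (-(Real.pi * τ.im / 2 * (N + 2))) / s, by positivity, ?_⟩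
  have h3 : conj (2 * u) = 2 * conj u := by rw [map_mul, map_ofNat]
  rw [weight_eq hτ, hs', h2, ← h3, ← conj_theta hτ hτ', Complex.mul_conj']
  push_cast
  ring

/-! ### The ratio of theta products -/

lemma differentiable_thetaProd {τ : ℂ} (hτ' : 0 < τ.im) (η : ℂ) (n : ℕ) (v : ℂ) :
    Differentiable ℂ (thetaProd τ η n v) := by
  have h := (contDiff_thetaProd hτ' η n (m := 1)).differentiable (by simp)
  exact h.comp (f := fun w => (v, w)) (by fun_prop)

/-- `∏_{k < n} θ₃(w ± v + (2k - n + 1)η) / θ₃(w ± u + (2k - n + 1)η)`. -/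
def thetaRatio (τ η : ℂ) (n : ℕ) (v u w : ℂ) : ℂ := thetaProd τ η n v w / thetaProd τ η n u w

/-- Over the common denominator the numerator is the addition formula at `x = w + (N+1)η`, `y = w -
(N+1)η`, for which `x + y = 2w` and `x - y = 2(N+1)η`. -/
lemma thetaRatio_sub {τ : ℂ} (hτ : τ.re = 0) (hτ' : 0 < τ.im) {v : ℂ} (hv : 2 * v ∉ lattice τ)
    (η : ℂ) (N : ℕ) {u w : ℂ} (h : thetaProd τ η (N + 2) u w ≠ 0) :
    thetaRatio τ η (N + 1) v u (w + η) - thetaRatio τ η (N + 1) v u (w - η) =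
      theta τ (2 * (N + 1) * η) * (thetaProd τ η N v w / thetaProd τ η (N + 2) u w *
        theta τ (2 * w) * thetaPair τ v u) := by
  have hadd := theta_addition hτ hτ' hv (w + (N + 1) * η) (w - (N + 1) * η) u
  rw [show w + (N + 1) * η + (w - (N + 1) * η) = 2 * w by ring,
    show w + (N + 1) * η - (w - (N + 1) * η) = 2 * (N + 1) * η by ring] at hadd
  rw [thetaProd_add_two] at h ⊢
  have h2 := right_ne_zero_of_mul h
  have h1 := right_ne_zero_of_mul (left_ne_zero_of_mul h)
  have h0 := left_ne_zero_of_mul (left_ne_zero_of_mul h)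
  simp only [thetaRatio, thetaProd_succ_add, thetaProd_succ_sub]
  generalize theta τ (2 * w) = a at *
  generalize theta τ (2 * (N + 1) * η) = b at *
  field_simp
  linear_combination thetaProd τ η N v w * hadd

lemma hasDerivAt_thetaRatio {τ : ℂ} (hτ' : 0 < τ.im) (η : ℂ) (n : ℕ) (v : ℂ) {u w : ℂ}
    (h : thetaProd τ η n u w ≠ 0) :
    HasDerivAt (thetaRatio τ η n v u) ((deriv (thetaProd τ η n v) w * thetaProd τ η n u w -
      thetaProd τ η n v w * deriv (thetaProd τ η n u) w) / thetaProd τ η n u w ^ 2) w :=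
  (differentiable_thetaProd hτ' η n v w).hasDerivAt.div
    (differentiable_thetaProd hτ' η n u w).hasDerivAt h

lemma differentiable_theta3Pair {τ : ℂ} (hτ' : 0 < τ.im) (v : ℂ) :
    Differentiable ℂ fun w => theta3Pair τ w v := by
  unfold theta3Pair
  fun_prop (disch := assumption)

/-- The confluent case of the addition formula. -/
lemma wronskian_theta3Pair {τ : ℂ} (hτ : τ.re = 0) (hτ' : 0 < τ.im) {v : ℂ}
    (hv : 2 * v ∉ lattice τ) (u w : ℂ) :
    deriv (fun w => theta3Pair τ w v) w * theta3Pair τ w u -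
      theta3Pair τ w v * deriv (fun w => theta3Pair τ w u) w =
      thetaDerivZero τ * (theta τ (2 * w) * thetaPair τ v u) := by
  have hv1 := (differentiable_theta3Pair hτ' v w).hasDerivAt
  have hu1 := (differentiable_theta3Pair hτ' u w).hasDerivAt
  set α := deriv (fun w => theta3Pair τ w v) w
  set β := deriv (fun w => theta3Pair τ w u) w
  have hp : ∀ {g : ℂ → ℂ} {g' : ℂ}, HasDerivAt g g' w → HasDerivAt (fun s => g (w + s)) g' 0 :=
    fun hg => HasDerivAt.comp_const_add w 0 (by simpa using hg)
  have hm : ∀ {g : ℂ → ℂ} {g' : ℂ}, HasDerivAt g g' w → HasDerivAt (fun s => g (w - s)) (-g') 0 :=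
    fun hg => HasDerivAt.comp_const_sub w 0 (by simpa using hg)
  -- The addition formula with `x = w + s`, `y = w - s` is differentiated at `s = 0`; both sides
  -- acquire a factor `2`.
  have h1 := ((hp hv1).mul (hm hu1)).sub ((hp hu1).mul (hm hv1))
  have h2 : HasDerivAt (fun s : ℂ => theta τ (2 * s) * (theta τ (2 * w) * thetaPair τ v u))
      (thetaDerivZero τ * 2 * (theta τ (2 * w) * thetaPair τ v u)) 0 := by
    refine HasDerivAt.mul_const ?_ _
    refine HasDerivAt.comp (h₂ := theta τ) (h := fun s : ℂ => 2 * s) (0 : ℂ) ?_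
      (by simpa using (hasDerivAt_id (0 : ℂ)).const_mul 2)
    simpa [thetaDerivZero] using hasDerivAt_theta_zero hτ hτ'
  have h3 : (fun s : ℂ => theta τ (2 * s) * (theta τ (2 * w) * thetaPair τ v u)) =
      (fun s => theta3Pair τ (w + s) v) * (fun s => theta3Pair τ (w - s) u) -
      (fun s => theta3Pair τ (w + s) u) * (fun s => theta3Pair τ (w - s) v) := by
    funext s
    simp only [Pi.sub_apply, Pi.mul_apply]
    rw [theta_addition hτ hτ' hv, show w + s + (w - s) = 2 * w by ring,
      show w + s - (w - s) = 2 * s by ring]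
    ring
  rw [h3] at h2
  have h4 := h1.unique h2
  simp only [add_zero, sub_zero] at h4
  linear_combination h4 / 2

open Classical in
/-- The quotient `θ(2(N+1)η) / η`, continued to `η = 0`. -/
def stepFactor (τ η : ℂ) (N : ℕ) : ℂ :=
  if η = 0 then 2 * (N + 1) * thetaDerivZero τ else theta τ (2 * (N + 1) * η) / η

lemma integral_deriv_thetaRatio {τ : ℂ} (hτ : τ.re = 0) (hτ' : 0 < τ.im) {v : ℂ}
    (hv : 2 * v ∉ lattice τ) {η : ℂ} {N : ℕ} (hη : Admissible τ η N) (u : ℂ) :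
    ∫ t : ℝ in (-1)..1, deriv (thetaRatio τ η (N + 1) v u) (conj u + t * η) =
      stepFactor τ η N * (thetaProd τ η N v (conj u) / thetaProd τ η (N + 2) u (conj u) *
        theta τ (2 * conj u) * thetaPair τ v u) := by
  have hne : ∀ t : ℝ, t ∈ Set.uIcc (-1 : ℝ) 1 →
      thetaProd τ η (N + 1) u (conj u + t * η) ≠ 0 := fun t ht => by
    rw [Set.uIcc_of_le (by norm_num)] at ht
    refine thetaProd_ne_zero hτ hτ' hη u ?_
    have := abs_le.mpr ht
    push_cast; linarith
  have hne2 := (thetaProd_pos hτ hτ' hη u).ne'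
  -- For `η = 0` the integrand is constant in `t` and the Wronskian evaluates it; otherwise `A(ū +
  -- tη) / η` is a primitive in `t` and the difference formula applies at the endpoints.
  by_cases h0 : η = 0
  · subst h0
    rw [stepFactor, if_pos rfl]
    have hnz : theta3Pair τ (conj u) u ≠ 0 := by
      have := theta3Pair_ne_zero hτ hτ' hη u (a := 0) (by simp; positivity)
      simpa using this
    have h1 : HasDerivAt (thetaRatio τ 0 (N + 1) v u)
        (((N + 1 : ℕ) : ℂ) * (theta3Pair τ (conj u) v / theta3Pair τ (conj u) u) ^ (N + 1 - 1) *
        ((deriv (fun w => theta3Pair τ w v) (conj u) * theta3Pair τ (conj u) u -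
      theta3Pair τ (conj u) v * deriv (fun w => theta3Pair τ w u) (conj u)) /
      theta3Pair τ (conj u) u ^ 2)) (conj u) := by
      have := ((differentiable_theta3Pair hτ' v (conj u)).hasDerivAt.div
        (differentiable_theta3Pair hτ' u (conj u)).hasDerivAt hnz).pow (N + 1)
      refine this.congr_of_eventuallyEq (Eventually.of_forall fun w => ?_)
      simp [thetaRatio, thetaProd_zero_step, div_pow]
    simp only [mul_zero, add_zero, h1.deriv, intervalIntegral.integral_const,
      wronskian_theta3Pair hτ hτ' hv, thetaProd_zero_step, Nat.add_sub_cancel, real_smul,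
      div_pow]
    push_cast
    field_simp
    ring
  · rw [stepFactor, if_neg h0]
    have hd : ∀ t ∈ Set.uIcc (-1 : ℝ) 1, HasDerivAt
        (fun t : ℝ => thetaRatio τ η (N + 1) v u (conj u + t * η) / η)
        (deriv (thetaRatio τ η (N + 1) v u) (conj u + t * η)) t := fun t ht => by
      have h1 := (hasDerivAt_thetaRatio hτ' η (N + 1) v (hne t ht)).differentiableAt.hasDerivAt
      have h2 : HasDerivAt (fun t : ℝ => conj u + t * η) η t := by
        simpa using ((Complex.ofRealCLM.hasDerivAt (x := t)).mul_const η).const_add (conj u)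
      refine ((h1.comp t h2).div_const η).congr_deriv ?_
      field_simp
    have hc : ContinuousOn (fun t : ℝ =>
        deriv (thetaRatio τ η (N + 1) v u) (conj u + t * η)) (Set.uIcc (-1) 1) := by
      refine ContinuousOn.congr (f := fun t : ℝ =>
        (deriv (thetaProd τ η (N + 1) v) (conj u + t * η) *
          thetaProd τ η (N + 1) u (conj u + t * η) - thetaProd τ η (N + 1) v (conj u + t * η) *
          deriv (thetaProd τ η (N + 1) u) (conj u + t * η)) /
          thetaProd τ η (N + 1) u (conj u + t * η) ^ 2) ?_
        fun t ht => (hasDerivAt_thetaRatio hτ' η (N + 1) v (hne t ht)).deriv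
      have hl : Continuous fun t : ℝ => conj u + t * η := by fun_prop
      have hP : ∀ z, Continuous fun t : ℝ => thetaProd τ η (N + 1) z (conj u + t * η) := fun z =>
        (differentiable_thetaProd hτ' η (N + 1) z).continuous.comp hl
      have hP' : ∀ z, Continuous fun t : ℝ =>
          deriv (thetaProd τ η (N + 1) z) (conj u + t * η) := fun z =>
        ((differentiable_thetaProd hτ' η (N + 1) z).contDiff.continuous_deriv (n := 1)
          le_rfl).comp hl
      exact ((((hP' v).mul (hP u)).sub ((hP v).mul (hP' u))).continuousOn).div
        ((hP u).pow 2).continuousOn fun t ht => pow_ne_zero 2 (hne t ht)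
    rw [intervalIntegral.integral_eq_sub_of_hasDerivAt hd hc.intervalIntegrable, ← sub_div]
    push_cast
    rw [one_mul, neg_one_mul, ← sub_eq_add_neg, thetaRatio_sub hτ hτ' hv η N hne2]
    ring

/-- The point `2(N+1)η` lies on an axis at distance less than one period from `0`, so it is a
lattice point only when `η = 0`. -/
lemma stepFactor_ne_zero {τ : ℂ} (hτ : τ.re = 0) (hτ' : 0 < τ.im) {η : ℂ} {N : ℕ}
    (hη : Admissible τ η N) : stepFactor τ η N ≠ 0 := by
  have hN : (N + 1 : ℂ) ≠ 0 := by exact_mod_cast Nat.succ_ne_zero N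
  have hN' : (0 : ℝ) < N + 1 := by positivity
  by_cases h0 : η = 0
  · rw [stepFactor, if_pos h0]
    exact mul_ne_zero (mul_ne_zero two_ne_zero hN) (thetaDerivZero_ne_zero hτ hτ')
  · rw [stepFactor, if_neg h0]
    refine div_ne_zero (fun h => h0 ?_) h0
    obtain ⟨m, n, hmn⟩ := mem_lattice.mp ((theta_eq_zero_iff hτ hτ').mp h)
    have hre := congrArg Complex.re hmn
    have him := congrArg Complex.im hmn
    simp [hτ] at hre him
    have h1 : |η.re| ≤ ‖η‖ := Complex.abs_re_le_norm η
    have h2 : |η.im| ≤ ‖η‖ := Complex.abs_im_le_norm η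
    rcases hη with ⟨h3, h4⟩ | ⟨h3, h4⟩
    · have h5 : |(m : ℝ)| < 1 := by
        rw [← hre, abs_mul, abs_of_pos (by positivity)]; nlinarith
      have h6 : m = 0 := Int.abs_lt_one_iff.mp (by exact_mod_cast h5)
      apply Complex.ext
      · rw [h6] at hre; simpa [hN'.ne'] using hre
      · simpa using h3
    · have h5 : |(n : ℝ)| * τ.im < 1 * τ.im := by
        rw [← abs_of_pos hτ', ← abs_mul, abs_of_pos hτ', ← him, abs_mul,
          abs_of_pos (by positivity)]; nlinarith
      have h6 : n = 0 := Int.abs_lt_one_iff.mp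
        (by exact_mod_cast lt_of_mul_lt_mul_right h5 hτ'.le)
      apply Complex.ext
      · simpa using h3
      · rw [h6] at him; simpa [hN'.ne'] using him

lemma kernelConst_eq {τ : ℂ} (hτ : τ.re = 0) (hτ' : 0 < τ.im) (η : ℂ) (N : ℕ) :
    kernelConst τ η N = 2 * cexp (3 * (Real.pi * I * τ / 4)) /
      (stepFactor τ η N * qPoch (nome τ) (nome τ) ^ 3) := by
  have hq := (qPoch_nome_pos hτ hτ').ne'
  have hpi : (Real.pi : ℂ) ≠ 0 := by exact_mod_cast Real.pi_ne_zero
  have hN : (N + 1 : ℂ) ≠ 0 := by exact_mod_cast Nat.succ_ne_zero N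
  have he : ∀ s : ℂ, 2 * Real.pi * I * τ * s = (8 * s) * (Real.pi * I * τ / 4) := fun s => by ring
  by_cases h0 : η = 0
  · rw [kernelConst, stepFactor, if_pos h0, if_pos h0, nome_cpow hτ, he, thetaDerivZero]
    have h3 : cexp (3 * (Real.pi * I * τ / 4)) = cexp (8 * (1 / 4) * (Real.pi * I * τ / 4)) *
      cexp (Real.pi * I * τ / 4) := by rw [← Complex.exp_add]; ring_nf
    rw [h3]
    have := Complex.exp_ne_zero (Real.pi * I * τ / 4)
    field_simp
  · rw [kernelConst, stepFactor, if_neg h0, if_neg h0, nome_cpow hτ, he]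
    norm_num
    rw [div_mul_eq_mul_div, div_div_eq_mul_div]
    ring

/-! ### Quasi-periodicity of the ingredients -/

lemma thetaRatio_add_one_left (τ η : ℂ) (n : ℕ) (v u w : ℂ) :
    thetaRatio τ η n v (u + 1) w = thetaRatio τ η n v u w := by
  simp only [thetaRatio, thetaProd_add_one]

lemma thetaRatio_add_tau_left {τ : ℂ} (hτ : τ.re = 0) (hτ' : 0 < τ.im) (η : ℂ) (n : ℕ)
    (v u w : ℂ) :
    thetaRatio τ η n v (u + τ) w = thetaRatio τ η n v u w / mult τ u ^ n := by
  simp only [thetaRatio, thetaProd_add_tau hτ hτ', div_div]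
  rw [mul_comm]

lemma thetaRatio_add_one_right (τ η : ℂ) (n : ℕ) (v u w : ℂ) :
    thetaRatio τ η n v u (w + 1) = thetaRatio τ η n v u w := by
  simp only [thetaRatio, thetaProd_comm τ η n _ (w + 1), thetaProd_add_one,
    thetaProd_comm τ η n w]

/-- The multiplier in `w` does not involve `v` or `u`, so it cancels. The shift is by `-τ` because
conjugation turns `u + τ` into `ū - τ`. -/
lemma thetaRatio_sub_tau_right {τ : ℂ} (hτ : τ.re = 0) (hτ' : 0 < τ.im) (η : ℂ) (n : ℕ)
    (v u w : ℂ) : thetaRatio τ η n v u (w - τ) = thetaRatio τ η n v u w := by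
  have h : ∀ z, thetaProd τ η n z w = mult τ (w - τ) ^ n * thetaProd τ η n z (w - τ) := fun z => by
    rw [thetaProd_comm, thetaProd_comm τ η n z, ← thetaProd_add_tau hτ hτ', sub_add_cancel]
  rw [thetaRatio, thetaRatio, h v, h u, mul_div_mul_left]
  exact pow_ne_zero _ (mult_ne_zero _ _)

lemma theta_two_mul_add_one (τ u : ℂ) : theta τ (2 * (u + 1)) = theta τ (2 * u) := by
  rw [show 2 * (u + 1) = 2 * u + 1 + 1 by ring, theta_add_one, theta_add_one, neg_neg]

lemma theta_two_mul_add_tau {τ : ℂ} (hτ : τ.re = 0) (hτ' : 0 < τ.im) (u : ℂ) :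
    theta τ (2 * (u + τ)) = mult τ u ^ 2 * theta τ (2 * u) := by
  rw [show 2 * (u + τ) = 2 * u + τ + τ by ring, theta_add_tau hτ hτ', theta_add_tau hτ hτ', mult,
    ← Complex.exp_nat_mul]
  have : cexp ((2 : ℕ) * -(2 * Real.pi * I * (2 * u + τ))) =
      cexp (-(Real.pi * I * τ)) * cexp (-(2 * Real.pi * I * (2 * u + τ))) *
      (cexp (-(Real.pi * I * τ)) * cexp (-(2 * Real.pi * I * (2 * u)))) := by
    simp only [← Complex.exp_add]; push_cast; ring_nf
  rw [this]
  ring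

lemma Theta_add_tau {τ : ℂ} {N : ℕ} {f : ℂ → ℂ} (hf : f ∈ Theta τ N) (u : ℂ) :
    f (u + τ) = mult τ u ^ N * f u := by
  rw [hf.2.2.1 u, mult, ← Complex.exp_nat_mul]
  ring_nf

lemma deriv_thetaPair_add_one (τ v u : ℂ) :
    deriv (thetaPair τ v) (u + 1) = deriv (thetaPair τ v) u := by
  have h : (fun y => thetaPair τ v (y + 1)) = thetaPair τ v := funext (thetaPair_add_one τ v)
  have := congrArg (fun f => deriv f u) h
  simpa [deriv_comp_add_const] using this

lemma deriv_thetaPair_add_tau {τ : ℂ} (hτ : τ.re = 0) (hτ' : 0 < τ.im) (v u : ℂ) :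
    deriv (thetaPair τ v) (u + τ) =
      mult τ u * (deriv (thetaPair τ v) u - 4 * Real.pi * I * thetaPair τ v u) := by
  have h : (fun y => thetaPair τ v (y + τ)) = fun y => mult τ y * thetaPair τ v y :=
    funext (thetaPair_add_tau hτ hτ' v)
  have h1 := congrArg (fun f => deriv f u) h
  simp only [deriv_comp_add_const] at h1
  have h2 : HasDerivAt (mult τ) (mult τ u * (-(4 * Real.pi * I))) u := by
    have := (((((hasDerivAt_id u).const_mul 2).add_const τ).const_mul (2 * Real.pi * I)).neg).cexp
    refine this.congr_deriv ?_
    simp only [mult, id, Pi.neg_apply]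
    ring
  rw [h1]
  refine (h2.mul (differentiable_thetaPair hτ' v u).hasDerivAt).deriv.trans ?_
  ring

lemma thetaPair_neg_right (τ v u : ℂ) : thetaPair τ v (-u) = thetaPair τ v u := by
  rw [thetaPair, thetaPair, sub_neg_eq_add, ← sub_eq_add_neg, mul_comm]

lemma thetaPair_self (τ v : ℂ) : thetaPair τ v v = 0 := by
  rw [thetaPair, sub_self, theta_zero, mul_zero]

lemma deriv_thetaPair_self {τ : ℂ} (hτ : τ.re = 0) (hτ' : 0 < τ.im) (v : ℂ) :
    deriv (thetaPair τ v) v = -(theta τ (2 * v) * thetaDerivZero τ) := by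
  rw [(hasDerivAt_thetaPair hτ' v v).deriv, sub_self, theta_zero, two_mul,
    (hasDerivAt_theta_zero hτ hτ').deriv, thetaDerivZero]
  ring

lemma deriv_thetaPair_neg {τ : ℂ} (hτ : τ.re = 0) (hτ' : 0 < τ.im) (v : ℂ) :
    deriv (thetaPair τ v) (-v) = theta τ (2 * v) * thetaDerivZero τ := by
  have h : (fun y => thetaPair τ v (-y)) = thetaPair τ v := funext (thetaPair_neg_right τ v)
  have := congrArg (fun f => deriv f v) h
  simp only [deriv_comp_neg] at this
  rw [← neg_neg (deriv _ (-v)), this, deriv_thetaPair_self hτ hτ', neg_neg]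

/-! ### The primitive of the reproducing integrand -/

/-- The numerator `f(u) θ(2u) P(v, w) + f(v) q'(u) P(u, w) / θ'(0)`, with `q(u) = θ(v ± u)`, of the
primitive. -/
def primNum (τ η : ℂ) (N : ℕ) (f : ℂ → ℂ) (v : ℂ) (x : ℂ × ℂ) : ℂ :=
  f x.1 * theta τ (2 * x.1) * thetaProd τ η (N + 1) v x.2 +
    f v / thetaDerivZero τ * deriv (thetaPair τ v) x.1 * thetaProd τ η (N + 1) x.1 x.2

/-- The numerator of the antiholomorphic derivative of the primitive. -/
def dbarNum (τ η : ℂ) (N : ℕ) (f : ℂ → ℂ) (v : ℂ) (x : ℂ × ℂ) : ℂ :=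
  f x.1 * theta τ (2 * x.1) *
    (deriv (thetaProd τ η (N + 1) v) x.2 * thetaProd τ η (N + 1) x.1 x.2 -
      thetaProd τ η (N + 1) v x.2 * deriv (thetaProd τ η (N + 1) x.1) x.2)

lemma contDiff_deriv_thetaProd {τ : ℂ} (hτ' : 0 < τ.im) (η : ℂ) (n : ℕ) :
    ContDiff ℂ 1 fun x : ℂ × ℂ => deriv (thetaProd τ η n x.1) x.2 := by
  have h := contDiff_thetaProd hτ' η n (m := 2)
  have he : (fun x : ℂ × ℂ => deriv (thetaProd τ η n x.1) x.2) = fun x =>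
      fderiv ℂ (fun x : ℂ × ℂ => thetaProd τ η n x.1 x.2) x (0, 1) := by
    funext x
    have h1 := ((h.differentiable (by simp)) x).hasFDerivAt
    have h2 : HasDerivAt (fun w : ℂ => (x.1, w)) (0, 1) x.2 :=
      (hasDerivAt_const _ _).prodMk (hasDerivAt_id _)
    exact (h1.comp_hasDerivAt x.2 h2).deriv
  rw [he]
  exact (h.fderiv_right (m := 1) (by norm_num)).clm_apply contDiff_const

/-! ### Vanishing of the two numerators at the zeros of `θ(v ± u)`. -/

section

variable {τ : ℂ} (hτ : τ.re = 0) (hτ' : 0 < τ.im) {N : ℕ} {f : ℂ → ℂ} (hf : f ∈ Theta τ N) {v : ℂ}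

include hτ' hf

lemma contDiff_mul_theta : ContDiff ℂ 1 fun x : ℂ × ℂ => f x.1 * theta τ (2 * x.1) := by
  have h1 : ContDiff ℂ 1 f := hf.1.contDiff
  have h2 : ContDiff ℂ 1 fun x : ℂ × ℂ => 2 * x.1 := by fun_prop
  exact (h1.comp contDiff_fst).mul ((contDiff_theta hτ').comp h2)

lemma contDiff_primNum (η : ℂ) : ContDiff ℂ 1 (primNum τ η N f v) := by
  have h1 : ContDiff ℂ 1 (deriv (thetaPair τ v)) :=
    (contDiff_succ_iff_deriv.mp ((differentiable_thetaPair hτ' v).contDiff (n := 1 + 1))).2.2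
  have h2 : ContDiff ℂ 1 fun x : ℂ × ℂ => thetaProd τ η (N + 1) v x.2 :=
    (contDiff_thetaProd hτ' η (N + 1)).comp (f := fun x : ℂ × ℂ => (v, x.2)) (by fun_prop)
  exact ((contDiff_mul_theta hτ' hf).mul h2).add
    ((contDiff_const.mul (h1.comp contDiff_fst)).mul (contDiff_thetaProd hτ' η (N + 1)))

lemma contDiff_dbarNum (η : ℂ) : ContDiff ℂ 1 (dbarNum τ η N f v) := by
  have h2 : ContDiff ℂ 1 fun x : ℂ × ℂ => thetaProd τ η (N + 1) v x.2 :=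
    (contDiff_thetaProd hτ' η (N + 1)).comp (f := fun x : ℂ × ℂ => (v, x.2)) (by fun_prop)
  have h3 : ContDiff ℂ 1 fun x : ℂ × ℂ => deriv (thetaProd τ η (N + 1) v) x.2 :=
    (contDiff_deriv_thetaProd hτ' η (N + 1)).comp (f := fun x : ℂ × ℂ => (v, x.2)) (by fun_prop)
  exact (contDiff_mul_theta hτ' hf).mul ((h3.mul (contDiff_thetaProd hτ' η (N + 1))).sub
    (h2.mul (contDiff_deriv_thetaProd hτ' η (N + 1))))

include hτ

lemma primNum_add_tau (η u w : ℂ) : primNum τ η N f v (u + τ, w) = mult τ u ^ (N + 2) *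
    (primNum τ η N f v (u, w) - f v / thetaDerivZero τ * (4 * Real.pi * I) * thetaPair τ v u *
      thetaProd τ η (N + 1) u w) := by
  simp only [primNum, Theta_add_tau hf, theta_two_mul_add_tau hτ hτ',
    deriv_thetaPair_add_tau hτ hτ', thetaProd_add_tau hτ hτ']
  ring

/-- At `u = ±v` the two theta products coincide, and `q'(±v) = ∓θ(2v) θ'(0)` makes the summands
cancel. Translation by `τ` adds a term proportional to `q`, so the vanishing of `q` is carried along
in the induction. -/
lemma primNum_eq_zero (η : ℂ) {a : ℂ} (ha : thetaPair τ v a = 0) (w : ℂ) :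
    primNum τ η N f v (a, w) = 0 := by
  have hd := thetaDerivZero_ne_zero hτ hτ'
  refine (of_thetaPair_eq_zero hτ hτ' (S := fun a => thetaPair τ v a = 0 ∧
    primNum τ η N f v (a, w) = 0) (fun x => ?_) (fun x => ?_) ⟨thetaPair_self τ v, ?_⟩ ⟨?_, ?_⟩ ha).2
  · simp only [thetaPair_add_one, primNum, hf.2.1, theta_two_mul_add_one,
      deriv_thetaPair_add_one, thetaProd_add_one]
  · simp only [primNum_add_tau hτ hτ' hf, thetaPair_add_tau hτ hτ', mul_eq_zero,
      pow_ne_zero (N + 2) (mult_ne_zero τ x), mult_ne_zero, false_or]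
    refine and_congr_right fun h => ?_
    rw [h, mul_zero, zero_mul, sub_zero]
  · simp only [primNum, deriv_thetaPair_self hτ hτ']
    field_simp
    ring
  · rw [thetaPair_neg_right, thetaPair_self]
  · simp only [primNum, deriv_thetaPair_neg hτ hτ', thetaProd_neg, hf.2.2.2, mul_neg,
      theta_neg hτ']
    field_simp
    ring

lemma dbarNum_eq_zero (η : ℂ) {a : ℂ} (ha : thetaPair τ v a = 0) (w : ℂ) :
    dbarNum τ η N f v (a, w) = 0 := by
  have h1 : ∀ x, thetaProd τ η (N + 1) (x + 1) = thetaProd τ η (N + 1) x := fun x =>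
    funext (thetaProd_add_one τ η (N + 1) x)
  have h2 : ∀ x, deriv (thetaProd τ η (N + 1) (x + τ)) w =
      mult τ x ^ (N + 1) * deriv (thetaProd τ η (N + 1) x) w := fun x => by
    rw [← deriv_const_mul_field]
    congr 1
    exact funext (thetaProd_add_tau hτ hτ' η (N + 1) x)
  have h3 : thetaProd τ η (N + 1) (-v) = thetaProd τ η (N + 1) v :=
    funext (thetaProd_neg τ η (N + 1) v)
  refine of_thetaPair_eq_zero hτ hτ' (S := fun a => dbarNum τ η N f v (a, w) = 0)
    (fun x => ?_) (fun x => ?_) ?_ ?_ ha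
  · simp only [dbarNum, hf.2.1, theta_two_mul_add_one, h1]
  · have : dbarNum τ η N f v (x + τ, w) = mult τ x ^ (2 * N + 3) * dbarNum τ η N f v (x, w) := by
      simp only [dbarNum, Theta_add_tau hf, theta_two_mul_add_tau hτ hτ', h2,
        thetaProd_add_tau hτ hτ']
      ring
    rw [this, mul_eq_zero, or_iff_right (pow_ne_zero _ (mult_ne_zero τ x))]
  · simp only [dbarNum]; ring
  · simp only [dbarNum, h3]; ring

end

/-- The primitive `h A + f(v) q' / (θ'(0) q)`, where `h(u) = f(u) θ(2u) / q(u)`,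
`q(u) = θ(v ± u)` and `A` is the ratio of theta products. -/
def prim (τ η : ℂ) (N : ℕ) (f : ℂ → ℂ) (v : ℂ) (x : ℂ × ℂ) : ℂ :=
  quotExt (primNum τ η N f v) (thetaPair τ v) x / thetaProd τ η (N + 1) x.1 x.2

/-- The antiholomorphic derivative `h ∂A` of the primitive. -/
def dbarPrim (τ η : ℂ) (N : ℕ) (f : ℂ → ℂ) (v : ℂ) (x : ℂ × ℂ) : ℂ :=
  quotExt (dbarNum τ η N f v) (thetaPair τ v) x / thetaProd τ η (N + 1) x.1 x.2 ^ 2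

lemma prim_eq {τ η : ℂ} {N : ℕ} {f : ℂ → ℂ} {v u w : ℂ} (hq : thetaPair τ v u ≠ 0)
    (hP : thetaProd τ η (N + 1) u w ≠ 0) : prim τ η N f v (u, w) =
      (f u * theta τ (2 * u) * thetaRatio τ η (N + 1) v u w +
        f v / thetaDerivZero τ * deriv (thetaPair τ v) u) / thetaPair τ v u := by
  rw [prim, quotExt_of_ne hq, primNum, thetaRatio]
  field_simp

lemma dbarPrim_eq {τ η : ℂ} (hτ' : 0 < τ.im) {N : ℕ} {f : ℂ → ℂ} {v u w : ℂ}
    (hq : thetaPair τ v u ≠ 0) (hP : thetaProd τ η (N + 1) u w ≠ 0) :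
    dbarPrim τ η N f v (u, w) =
      f u * theta τ (2 * u) / thetaPair τ v u * deriv (thetaRatio τ η (N + 1) v u) w := by
  rw [dbarPrim, quotExt_of_ne hq, dbarNum, (hasDerivAt_thetaRatio hτ' η (N + 1) v hP).deriv]
  field_simp

/-! ### Continuity, quasi-periods and boundary integral of the primitive. -/

section

variable {τ : ℂ} (hτ : τ.re = 0) (hτ' : 0 < τ.im) {N : ℕ} {f : ℂ → ℂ} (hf : f ∈ Theta τ N) {v : ℂ}
  (hv : 2 * v ∉ lattice τ) {η : ℂ}

include hτ hτ' hf hv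

lemma continuousAt_prim {x : ℂ × ℂ} (hP : thetaProd τ η (N + 1) x.1 x.2 ≠ 0) :
    ContinuousAt (prim τ η N f v) x :=
  (continuous_quotExt (contDiff_primNum hτ' hf η) (differentiable_thetaPair hτ' v)
    (fun _ => deriv_thetaPair_ne_zero hτ hτ' hv)
    (fun _ => primNum_eq_zero hτ hτ' hf η)).continuousAt.div
    (contDiff_thetaProd hτ' η (N + 1) (m := 1)).continuous.continuousAt hP

lemma continuousAt_dbarPrim {x : ℂ × ℂ} (hP : thetaProd τ η (N + 1) x.1 x.2 ≠ 0) :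
    ContinuousAt (dbarPrim τ η N f v) x :=
  (continuous_quotExt (contDiff_dbarNum hτ' hf η) (differentiable_thetaPair hτ' v)
    (fun _ => deriv_thetaPair_ne_zero hτ hτ' hv)
    (fun _ => dbarNum_eq_zero hτ hτ' hf η)).continuousAt.div
    ((contDiff_thetaProd hτ' η (N + 1) (m := 1)).continuous.continuousAt.pow 2) (pow_ne_zero 2 hP)

variable {s : ℂ} (hs : ∀ u, thetaProd τ η (N + 1) u (conj u + s) ≠ 0)

include hs

lemma continuous_prim_conj : Continuous fun u => prim τ η N f v (u, conj u + s) :=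
  continuous_iff_continuousAt.mpr fun u =>
    ContinuousAt.comp (f := fun u => (u, conj u + s)) (continuousAt_prim hτ hτ' hf hv (hs u))
      (by have := continuous_conj; fun_prop)

lemma continuous_dbarPrim_conj : Continuous fun u => dbarPrim τ η N f v (u, conj u + s) :=
  continuous_iff_continuousAt.mpr fun u =>
    ContinuousAt.comp (f := fun u => (u, conj u + s)) (continuousAt_dbarPrim hτ hτ' hf hv (hs u))
      (by have := continuous_conj; fun_prop)

lemma prim_add_one (u : ℂ) :
    prim τ η N f v (u + 1, conj (u + 1) + s) = prim τ η N f v (u, conj u + s) := by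
  have hc := continuous_prim_conj hτ hτ' hf hv hs
  refine congrFun (Continuous.ext_on (dense_thetaPair_ne_zero hτ hτ' v)
    (hc.comp (continuous_add_const 1)) hc fun u hu => ?_) u
  have hu' : thetaPair τ v (u + 1) ≠ 0 := by rwa [thetaPair_add_one]
  rw [Function.comp_apply, prim_eq hu (hs u), prim_eq hu' (hs _), thetaPair_add_one, hf.2.1,
    theta_two_mul_add_one, deriv_thetaPair_add_one, thetaRatio_add_one_left, map_add, map_one,
    show conj u + 1 + s = conj u + s + 1 by ring, thetaRatio_add_one_right]

/-- In `h A` the multipliers cancel: `N + 2 - 1` powers from `h` against `N + 1` from `A`. Only the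
logarithmic derivative `q' / q` is not periodic, and it changes by `-4πi`. -/
lemma prim_add_tau (u : ℂ) :
    prim τ η N f v (u + τ, conj (u + τ) + s) = prim τ η N f v (u, conj u + s) -
      4 * Real.pi * I * (f v / thetaDerivZero τ) := by
  have hc := continuous_prim_conj hτ hτ' hf hv hs
  refine congrFun (Continuous.ext_on (dense_thetaPair_ne_zero hτ hτ' v)
    (hc.comp (continuous_add_const τ)) (g := fun u => prim τ η N f v (u, conj u + s) -
      4 * Real.pi * I * (f v / thetaDerivZero τ)) (hc.sub continuous_const) fun u hu => ?_) u
  have hm := mult_ne_zero τ u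
  have hu' : thetaPair τ v (u + τ) ≠ 0 := by
    rw [thetaPair_add_tau hτ hτ']; exact mul_ne_zero hm hu
  have hu : thetaPair τ v u ≠ 0 := hu
  beta_reduce
  rw [Function.comp_apply, prim_eq hu (hs u), prim_eq hu' (hs _), thetaPair_add_tau hτ hτ',
    Theta_add_tau hf, theta_two_mul_add_tau hτ hτ', deriv_thetaPair_add_tau hτ hτ',
    thetaRatio_add_tau_left hτ hτ', map_add, conj_eq_neg hτ,
    show conj u + -τ + s = conj u + s - τ by ring, thetaRatio_sub_tau_right hτ hτ']
  field_simp
  ring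

omit hτ hv in
-- Off the zeros of `q`, `prim` is holomorphic in `(u, w)`. The chain rule along `w = ū + s` makes
-- its `w`-derivative the `∂̄`-derivative; the correction term does not depend on `w`.
lemma hasFDerivAt_prim_conj {u : ℂ} (hu : thetaPair τ v u ≠ 0) :
    HasFDerivAt (fun u => prim τ η N f v (u, conj u + s))
      (fderiv ℂ (prim τ η N f v) (u, conj u + s) (1, 0) • ContinuousLinearMap.id ℝ ℂ +
        dbarPrim τ η N f v (u, conj u + s) • (conjCLE : ℂ →L[ℝ] ℂ)) u := by
  set w := conj u + s with hw
  have hP : thetaProd τ η (N + 1) u w ≠ 0 := hs u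
  have hd : DifferentiableAt ℂ (prim τ η N f v) (u, w) := by
    have h1 : DifferentiableAt ℂ (fun x : ℂ × ℂ => primNum τ η N f v x / thetaPair τ v x.1 /
        thetaProd τ η (N + 1) x.1 x.2) (u, w) := by
      have h1 := (contDiff_primNum hτ' hf (v := v) η).differentiable (by simp) (u, w)
      have h2 : DifferentiableAt ℂ (fun x : ℂ × ℂ => thetaPair τ v x.1) (u, w) :=
        ((differentiable_thetaPair hτ' v).comp differentiable_fst) _
      have h3 := (contDiff_thetaProd hτ' η (N + 1) (m := 1)).differentiable (by simp) (u, w)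
      simp only [div_eq_mul_inv]
      exact (h1.fun_mul (h2.fun_inv hu)).fun_mul (h3.fun_inv hP)
    refine h1.congr_of_eventuallyEq ?_
    have : ∀ᶠ x : ℂ × ℂ in 𝓝 (u, w), thetaPair τ v x.1 ≠ 0 :=
      (((differentiable_thetaPair hτ' v).continuous.comp continuous_fst).continuousAt
        (x := (u, w))).eventually_ne hu
    filter_upwards [this] with x hx
    rw [prim, quotExt_of_ne hx]
  have hdw : fderiv ℂ (prim τ η N f v) (u, w) (0, 1) = dbarPrim τ η N f v (u, w) := by
    have h2 : HasDerivAt (fun w : ℂ => (u, w)) (0, 1) w :=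
      (hasDerivAt_const _ _).prodMk (hasDerivAt_id _)
    have h3 := hd.hasFDerivAt.comp_hasDerivAt w h2
    have h4 := (((hasDerivAt_thetaRatio hτ' η (N + 1) v hP).const_mul
      (f u * theta τ (2 * u))).add_const
        (f v / thetaDerivZero τ * deriv (thetaPair τ v) u)).div_const (thetaPair τ v u)
    have h5 : ∀ᶠ z in 𝓝 w, thetaProd τ η (N + 1) u z ≠ 0 :=
      (differentiable_thetaProd hτ' η (N + 1) u).continuous.continuousAt.eventually_ne hP
    have h6 := h4.congr_of_eventuallyEq (f₁ := prim τ η N f v ∘ fun w => (u, w)) (by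
      filter_upwards [h5] with z hz using prim_eq hu hz)
    rw [h3.unique h6, dbarPrim_eq hτ' hu hP, (hasDerivAt_thetaRatio hτ' η (N + 1) v hP).deriv]
    ring
  have hc : HasFDerivAt (fun u : ℂ => (u, conj u + s))
      ((ContinuousLinearMap.id ℝ ℂ).prod (conjCLE : ℂ →L[ℝ] ℂ)) u :=
    (hasFDerivAt_id u).prodMk ((conjCLE : ℂ →L[ℝ] ℂ).hasFDerivAt.add_const s)
  have h := (hd.hasFDerivAt.restrictScalars ℝ).comp u hc
  refine h.congr_fderiv ?_
  ext1
  rename_i z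
  rw [← hdw]
  have : ∀ a b : ℂ, fderiv ℂ (prim τ η N f v) (u, w) (a, b) =
      fderiv ℂ (prim τ η N f v) (u, w) (1, 0) * a + fderiv ℂ (prim τ η N f v) (u, w) (0, 1) * b := by
    intro a b
    have h : ((a, b) : ℂ × ℂ) = a • ((1, 0) : ℂ × ℂ) + b • ((0, 1) : ℂ × ℂ) := by ext <;> simp
    rw [h, map_add, map_smul, map_smul, smul_eq_mul, smul_eq_mul]
    ring
  simpa using this z (conj z)

/-- Stokes' theorem on the period rectangle. -/
lemma integral_dbarPrim :
    ∫ x : ℝ in 0..1, ∫ y : ℝ in 0..τ.im, dbarPrim τ η N f v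
      ((x + y * I : ℂ), conj (x + y * I : ℂ) + s) = 2 * Real.pi * (f v / thetaDerivZero τ) := by
  set G : ℂ → ℂ := fun u => prim τ η N f v (u, conj u + s) with hG
  have hGc : Continuous G := continuous_prim_conj hτ hτ' hf hv hs
  have hbc := continuous_dbarPrim_conj hτ hτ' hf hv hs
  set G' : ℂ → ℂ →L[ℝ] ℂ := fun u =>
    fderiv ℂ (prim τ η N f v) (u, conj u + s) (1, 0) • ContinuousLinearMap.id ℝ ℂ +
        dbarPrim τ η N f v (u, conj u + s) • (conjCLE : ℂ →L[ℝ] ℂ) with hG'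
  -- For a differential `a dz + b dz̄` the Stokes integrand is `2ib`, so the unbounded candidates
  -- for `a` near the zeros of `q` play no role.
  have hb : ∀ u, I • G' u 1 - G' u I = 2 * I * dbarPrim τ η N f v (u, conj u + s) := by
    intro u
    simp [hG']
    ring
  have hst := Complex.integral_boundary_rect_of_hasFDerivAt_real_off_countable G G' 0 (1 + τ)
    {u | thetaPair τ v u = 0} (countable_zeros_thetaPair hτ hτ' v) hGc.continuousOn
    (fun u hu => hasFDerivAt_prim_conj hτ' hf hs hu.2) (by
      simp only [hb]
      exact (Continuous.continuousOn (by fun_prop)).integrableOn_compact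
        (isCompact_uIcc.reProdIm isCompact_uIcc))
  have hττ : (τ.im : ℂ) * I = τ := by apply Complex.ext <;> simp [hτ]
  simp only [hb, zero_re, zero_im, add_re, add_im, one_re, one_im, hτ, add_zero, zero_add,
    ofReal_zero, ofReal_one, zero_mul, hττ] at hst
  have h1 : ∀ y : ℝ, G (1 + y * I) = G (y * I) := fun y => by
    rw [add_comm]; exact prim_add_one hτ hτ' hf hv hs _
  have h2 : ∀ x : ℝ, G (x + τ) = G x - 4 * Real.pi * I * (f v / thetaDerivZero τ) := fun x =>
    prim_add_tau hτ hτ' hf hv hs _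
  -- The vertical sides cancel by the period `1`; the horizontal ones differ by the constant `4πi
  -- f(v) / θ'(0)`.
  simp only [h1, h2, add_sub_cancel_right] at hst
  have hGi : IntervalIntegrable (fun x : ℝ => G x) volume 0 1 :=
    (hGc.comp continuous_ofReal).intervalIntegrable _ _
  rw [intervalIntegral.integral_sub hGi (by simp)] at hst
  simp only [intervalIntegral.integral_const_mul, intervalIntegral.integral_const] at hst
  simp only [sub_zero, one_smul] at hst
  have h2I : (2 * I : ℂ) ≠ 0 := by simp
  refine mul_left_cancel₀ h2I ?_
  rw [← hst]
  ring

end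

/-! ### Integration over the period rectangle -/

lemma periodDomain_subset (τ : ℂ) : periodDomain τ ⊆ Set.Icc 0 1 ×ℂ Set.Icc 0 τ.im :=
  fun _ h => ⟨Set.Ico_subset_Icc_self h.1, Set.Ico_subset_Icc_self h.2⟩

lemma integrableOn_periodDomain (τ : ℂ) {g : ℂ → ℂ} (hg : Continuous g) :
    IntegrableOn g (periodDomain τ) :=
  (hg.continuousOn.integrableOn_compact (isCompact_Icc.reProdIm isCompact_Icc)).mono_set
    (periodDomain_subset τ)

lemma setIntegral_periodDomain {τ : ℂ} (hτ' : 0 < τ.im) {g : ℂ → ℂ} (hg : Continuous g) :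
    ∫ u in periodDomain τ, g u = ∫ x : ℝ in 0..1, ∫ y : ℝ in 0..τ.im, g (x + y * I) := by
  have h1 := Complex.volume_preserving_equiv_real_prod.symm.setIntegral_preimage_emb
    measurableEquivRealProd.symm.measurableEmbedding g (periodDomain τ)
  have h2 : measurableEquivRealProd.symm ⁻¹' periodDomain τ = Set.Ico 0 1 ×ˢ Set.Ico 0 τ.im := by
    ext ⟨x, y⟩
    simp [periodDomain, measurableEquivRealProd]
  have h3 : IntegrableOn (fun p : ℝ × ℝ => g (p.1 + p.2 * I)) (Set.Ico 0 1 ×ˢ Set.Ico 0 τ.im)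
      (volume.prod volume) := by
    have hc : Continuous fun p : ℝ × ℝ => g (p.1 + p.2 * I) := by fun_prop
    exact (hc.continuousOn.integrableOn_compact
      ((isCompact_Icc (a := (0 : ℝ)) (b := 1)).prod (isCompact_Icc (a := 0) (b := τ.im)))).mono_set
      (Set.prod_mono Set.Ico_subset_Icc_self Set.Ico_subset_Icc_self)
  rw [← h1, h2]
  have h4 : ∀ p : ℝ × ℝ, measurableEquivRealProd.symm p = p.1 + p.2 * I := fun p => by
    apply Complex.ext <;> simp [measurableEquivRealProd]
  simp only [h4]
  rw [Measure.volume_eq_prod, setIntegral_prod _ h3, intervalIntegral.integral_of_le zero_le_one,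
    integral_Ico_eq_integral_Ioc]
  simp only [intervalIntegral.integral_of_le hτ'.le, integral_Ico_eq_integral_Ioc]

lemma setIntegral_periodDomain_swap (τ : ℂ) {b : ℂ → ℝ → ℂ}
    (hb : ContinuousOn b.uncurry (Set.univ ×ˢ Set.Icc (-1) 1)) :
    ∫ u in periodDomain τ, ∫ t in (-1)..1, b u t = ∫ t in (-1)..1, ∫ u in periodDomain τ, b u t := by
  simp only [intervalIntegral.integral_of_le (show (-1 : ℝ) ≤ 1 by norm_num)]
  refine integral_integral_swap ?_
  rw [Measure.prod_restrict]
  have hK : IsCompact ((Set.Icc 0 1 ×ℂ Set.Icc 0 τ.im) ×ˢ Set.Icc (-1 : ℝ) 1) :=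
    (isCompact_Icc.reProdIm isCompact_Icc).prod isCompact_Icc
  exact ((hb.mono (Set.prod_mono (Set.subset_univ _) subset_rfl)).integrableOn_compact hK).mono_set
    (Set.prod_mono (periodDomain_subset τ) Set.Ioc_subset_Icc_self)

/-! ### The scalar product -/

lemma dense_two_mul_notMem_lattice (τ : ℂ) : Dense {v | 2 * v ∉ lattice τ} := by
  have h : {v | 2 * v ∈ lattice τ}.Countable :=
    ((countable_lattice τ).image fun l => l / 2).mono fun v hv =>
      (Set.mem_image ..).mpr ⟨2 * v, hv, by simp⟩
  exact h.dense_compl ℝ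

section

variable {τ η : ℂ} {N : ℕ} (hτ : τ.re = 0) (hτ' : 0 < τ.im) (hη : Admissible τ η N)

include hτ hτ' hη

lemma continuous_weight_conj : Continuous fun u => weight τ η N u (conj u) := by
  have hcj := continuous_conj
  have hP : Continuous fun u => thetaProd τ η (N + 2) u (conj u) :=
    (contDiff_thetaProd hτ' η (N + 2) (m := 1)).continuous.comp
      (f := fun u => (u, conj u)) (by fun_prop)
  simp only [weight_eq hτ]
  refine Continuous.div ?_ hP fun u => (thetaProd_pos hτ hτ' hη u).ne'
  have h := continuous_theta hτ'
  exact continuous_const.mul ((h.comp (continuous_const_mul 2)).mul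
    (h.comp ((continuous_const_mul 2).comp hcj)))

lemma continuous_metricIntegrand {f g : ℂ → ℂ} (hf : Continuous f) (hg : Continuous g) :
    Continuous (metricIntegrand τ η N f g) :=
  (hf.mul (continuous_conj.comp hg)).mul (continuous_weight_conj hτ hτ' hη)

lemma isScalarProduct_metric : IsScalarProduct (Theta τ N) (metric τ η N) where
  add_left f hf g hg h hh := by
    have h1 := integrableOn_periodDomain τ
      (continuous_metricIntegrand hτ hτ' hη hf.1.continuous hh.1.continuous)
    have h2 := integrableOn_periodDomain τ
      (continuous_metricIntegrand hτ hτ' hη hg.1.continuous hh.1.continuous)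
    rw [metric, metric, metric, ← integral_add h1 h2]
    refine integral_congr_ae (Eventually.of_forall fun u => ?_)
    simp only [metricIntegrand, Pi.add_apply]
    ring
  smul_left c f _ g _ := by
    rw [metric, metric, ← integral_const_mul]
    refine integral_congr_ae (Eventually.of_forall fun u => ?_)
    simp only [metricIntegrand, Pi.smul_apply, smul_eq_mul]
    ring
  conj_symm f _ g _ := by
    rw [metric, metric, ← integral_conj]
    refine integral_congr_ae (Eventually.of_forall fun u => ?_)
    obtain ⟨r, _, hr⟩ := weight_conj_eq hτ hτ' hη u
    simp only [metricIntegrand, hr, map_mul, conj_conj, conj_ofReal]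
    ring
  pos_def f hf hf0 := by
    have hfc := hf.1.continuous
    set φ : ℂ → ℝ := fun u => (metricIntegrand τ η N f f u).re with hφ
    have hcont := continuous_metricIntegrand hτ hτ' hη hfc hfc
    have hφc : Continuous φ := Complex.continuous_re.comp hcont
    have hval : ∀ u, ∃ r : ℝ, 0 < r ∧ φ u = r * ‖f u * theta τ (2 * u)‖ ^ 2 := fun u => by
      obtain ⟨r, hr0, hr⟩ := weight_conj_eq hτ hτ' hη u
      refine ⟨r, hr0, ?_⟩
      simp only [hφ, metricIntegrand, hr, Complex.mul_conj']
      norm_cast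
      rw [norm_mul]
      ring
    have hre : (metric τ η N f f).re = ∫ u in periodDomain τ, φ u :=
      (integral_re (𝕜 := ℂ) (integrableOn_periodDomain τ hcont)).symm
    have hint : IntegrableOn φ (periodDomain τ) := (integrableOn_periodDomain τ hcont).re
    rw [hre, setIntegral_pos_iff_support_of_nonneg_ae (Eventually.of_forall fun u => by
      obtain ⟨r, hr0, hr⟩ := hval u
      simp only [hr, Pi.zero_apply]; positivity) hint]
    set U : Set ℂ := Set.Ioo 0 1 ×ℂ Set.Ioo 0 τ.im with hU
    have hUo : IsOpen U := isOpen_Ioo.reProdIm isOpen_Ioo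
    have hUs : U ⊆ periodDomain τ :=
      fun _ h => ⟨Set.Ioo_subset_Ico_self h.1, Set.Ioo_subset_Ico_self h.2⟩
    have hpt : (⟨1 / 2, τ.im / 2⟩ : ℂ) ∈ U :=
      ⟨⟨by norm_num, by norm_num⟩, ⟨by simpa using hτ', by simpa using hτ'⟩⟩
    -- Otherwise the entire function `f(u) θ(2u)` would vanish identically, and `f` would vanish on
    -- the dense set where `θ(2u) ≠ 0`.
    obtain ⟨u, huU, hu⟩ : ∃ u ∈ U, f u * theta τ (2 * u) ≠ 0 := by
      by_contra hcon
      push Not at hcon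
      have hd : Differentiable ℂ fun u => f u * theta τ (2 * u) :=
        hf.1.mul ((differentiable_theta hτ').comp (differentiable_id.const_mul 2))
      have hz := (hd.differentiableOn.analyticOnNhd isOpen_univ).eq_of_eventuallyEq
        (g := 0) analyticOnNhd_const (z₀ := ⟨1 / 2, τ.im / 2⟩)
        (by filter_upwards [hUo.mem_nhds hpt] with z hz using hcon z hz)
      refine hf0 (Continuous.ext_on (dense_two_mul_notMem_lattice τ) hfc continuous_const
        fun u hu => ?_)
      have h1 := congrFun hz u
      have h2 : theta τ (2 * u) ≠ 0 := fun h => hu ((theta_eq_zero_iff hτ hτ').mp h)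
      simpa [h2] using h1
    refine (((hφc.isOpen_support.inter hUo).measure_pos volume ⟨u, ?_, huU⟩)).trans_le
      (measure_mono (Set.inter_subset_inter_right _ hUs))
    obtain ⟨r, hr0, hr⟩ := hval u
    rw [Function.mem_support, hr]
    have := norm_pos_iff.mpr hu
    positivity

omit hτ hτ' hη in
lemma conj_exp_pi_mul (hτ : τ.re = 0) (r : ℝ) :
    conj (cexp (Real.pi * I * τ * r)) = cexp (Real.pi * I * τ * r) := by
  simp [← Complex.exp_conj, conj_eq_neg hτ]

lemma conj_stepFactor : conj (stepFactor τ η N) = stepFactor τ η N := by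
  have hd : conj (thetaDerivZero τ) = thetaDerivZero τ := by
    have h1 := conj_exp_pi_mul hτ (1 / 4)
    rw [show Real.pi * I * τ * (1 / 4 : ℝ) = Real.pi * I * τ / 4 by push_cast; ring] at h1
    simp only [thetaDerivZero, map_mul, map_pow, conj_qPoch, conj_nome hτ, h1, map_ofNat,
      conj_ofReal]
  by_cases h0 : η = 0
  · simp only [stepFactor, if_pos h0, map_mul, hd, map_ofNat, map_add, map_natCast, map_one]
  · simp only [stepFactor, if_neg h0, map_div₀, conj_theta hτ hτ', map_mul, map_ofNat, map_add,
      map_natCast, map_one]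
    rcases hη.im_or_re with h | h
    · rw [Complex.conj_eq_iff_im.mpr h]
    -- For imaginary `η` the sign changes of the odd numerator and of `η` cancel.
    · rw [conj_eq_neg h, mul_neg, theta_neg hτ', neg_div_neg_eq]

lemma conj_kernelConst : conj (kernelConst τ η N) = kernelConst τ η N := by
  have h1 := conj_exp_pi_mul hτ (3 / 4)
  rw [show Real.pi * I * τ * (3 / 4 : ℝ) = 3 * (Real.pi * I * τ / 4) by push_cast; ring] at h1
  simp only [kernelConst_eq hτ hτ', map_div₀, map_mul, map_pow, conj_qPoch, conj_nome hτ, h1,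
    map_ofNat, conj_stepFactor hτ hτ' hη]

omit hτ' in
lemma conj_sklyaninKernel (v u : ℂ) : conj (sklyaninKernel τ η N v u) =
    cexp (-(Real.pi * I * τ / 2 * N)) * thetaProd τ η N v (conj u) := by
  have h1 := conj_exp_pi_mul hτ (-(N / 2))
  rw [show Real.pi * I * τ * (-(N / 2) : ℝ) = -(Real.pi * I * τ / 2 * N) by
    push_cast; ring] at h1
  rw [sklyaninKernel_eq hτ, map_mul, h1, conj_thetaProd hτ hη.im_or_re, conj_conj]

omit hη in
lemma sklyaninKernel_mem (η v : ℂ) : sklyaninKernel τ η N v ∈ Theta τ N := by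
  have he : sklyaninKernel τ η N v = fun u =>
      cexp (-(Real.pi * I * τ / 2 * N)) * thetaProd τ η N u (conj v) := by
    funext u
    rw [sklyaninKernel_eq hτ, thetaProd_comm]
  rw [he]
  have hd : Differentiable ℂ fun u => thetaProd τ η N u (conj v) := by
    simp only [thetaProd_comm τ η N _ (conj v)]
    exact differentiable_thetaProd hτ' η N (conj v)
  refine ⟨hd.const_mul _, fun u => ?_, fun u => ?_, fun u => ?_⟩
  · simp only [thetaProd_add_one]
  · simp only [thetaProd_add_tau hτ hτ']
    rw [mult, ← Complex.exp_nat_mul]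
    ring_nf
  · simp only [thetaProd_neg]

/-! ### The reproducing property -/

variable {f : ℂ → ℂ}

/-- The average over `t` replaces the difference quotient of `A` with step `η`. The factor `e^{πiτ}
= p^{1/2}` is what remains of the exponentials of kernel and weight. -/
lemma metricIntegrand_kernel_eq {v u : ℂ} (hv : 2 * v ∉ lattice τ) (hu : thetaPair τ v u ≠ 0) :
    metricIntegrand τ η N f (fun u => (kernelConst τ η N)⁻¹ * sklyaninKernel τ η N v u) u =
      (kernelConst τ η N)⁻¹ * cexp (Real.pi * I * τ) / stepFactor τ η N *
        ∫ t : ℝ in (-1)..1, dbarPrim τ η N f v (u, conj u + t * η) := by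
  have hne : ∀ t : ℝ, t ∈ Set.uIcc (-1 : ℝ) 1 →
      thetaProd τ η (N + 1) u (conj u + t * η) ≠ 0 := fun t ht => by
    rw [Set.uIcc_of_le (by norm_num)] at ht
    refine thetaProd_ne_zero hτ hτ' hη u ?_
    have := abs_le.mpr ht
    push_cast; linarith
  rw [intervalIntegral.integral_congr fun t ht => dbarPrim_eq hτ' hu (hne t ht),
    intervalIntegral.integral_const_mul, integral_deriv_thetaRatio hτ hτ' hv hη]
  have hL := stepFactor_ne_zero hτ hτ' hη
  have hP := (thetaProd_pos hτ hτ' hη u).ne'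
  have he : cexp (-(Real.pi * I * τ / 2 * N)) * cexp (Real.pi * I * τ / 2 * (N + 2)) =
      cexp (Real.pi * I * τ) := by rw [← Complex.exp_add]; ring_nf
  rw [metricIntegrand, map_mul, map_inv₀, conj_kernelConst hτ hτ' hη,
    conj_sklyaninKernel hτ hη, weight_eq hτ, ← he]
  field_simp

lemma metric_kernel_of_notMem (hf : f ∈ Theta τ N) {v : ℂ} (hv : 2 * v ∉ lattice τ) :
    metric τ η N f (fun u => (kernelConst τ η N)⁻¹ * sklyaninKernel τ η N v u) = f v := by
  have hne : ∀ t : ℝ, t ∈ Set.Icc (-1 : ℝ) 1 → ∀ u,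
      thetaProd τ η (N + 1) u (conj u + t * η) ≠ 0 := fun t ht u => by
    refine thetaProd_ne_zero hτ hτ' hη u ?_
    have := abs_le.mpr ht
    push_cast; linarith
  have hae : ∀ᵐ u ∂(volume.restrict (periodDomain τ)), thetaPair τ v u ≠ 0 :=
    ae_restrict_of_ae (measure_eq_zero_iff_ae_notMem.mp
      ((countable_zeros_thetaPair hτ hτ' v).measure_zero volume))
  have hcont : ContinuousOn
      (Function.uncurry fun (u : ℂ) (t : ℝ) => dbarPrim τ η N f v (u, conj u + t * η))
      (Set.univ ×ˢ Set.Icc (-1) 1) := fun x hx => by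
    have hcj := continuous_conj
    refine ContinuousAt.continuousWithinAt ?_
    exact ContinuousAt.comp (f := fun x : ℂ × ℝ => (x.1, conj x.1 + x.2 * η))
      (continuousAt_dbarPrim hτ hτ' hf hv (hne x.2 hx.2 x.1)) (by fun_prop)
  -- Stokes gives the same value for every shift `tη`, so after exchanging the integrals the average
  -- over `t` only contributes the length `2`.
  have hinner : ∀ t ∈ Set.uIcc (-1 : ℝ) 1,
      ∫ u in periodDomain τ, dbarPrim τ η N f v (u, conj u + t * η) =
      2 * Real.pi * (f v / thetaDerivZero τ) := fun t ht => by
    rw [Set.uIcc_of_le (by norm_num)] at ht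
    rw [setIntegral_periodDomain hτ' (continuous_dbarPrim_conj hτ hτ' hf hv (hne t ht)),
      integral_dbarPrim hτ hτ' hf hv (hne t ht)]
  rw [metric, integral_congr_ae (hae.mono fun u hu => metricIntegrand_kernel_eq hτ hτ' hη hv hu),
    integral_const_mul, setIntegral_periodDomain_swap τ hcont,
    intervalIntegral.integral_congr hinner, intervalIntegral.integral_const, kernelConst_eq hτ hτ',
    thetaDerivZero]
  have hL := stepFactor_ne_zero hτ hτ' hη
  have hq := (qPoch_nome_pos hτ hτ').ne'
  have hpi : (Real.pi : ℂ) ≠ 0 := by exact_mod_cast Real.pi_ne_zero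
  have he : cexp (Real.pi * I * τ) =
      cexp (3 * (Real.pi * I * τ / 4)) * cexp (Real.pi * I * τ / 4) := by
    rw [← Complex.exp_add]; ring_nf
  have h1 := Complex.exp_ne_zero (3 * (Real.pi * I * τ / 4))
  have h2 := Complex.exp_ne_zero (Real.pi * I * τ / 4)
  rw [he]
  generalize cexp (3 * (Real.pi * I * τ / 4)) = a at *
  generalize cexp (Real.pi * I * τ / 4) = b at *
  rw [real_smul]
  push_cast
  field_simp
  norm_num

lemma metric_kernel (hf : f ∈ Theta τ N) (v : ℂ) :
    metric τ η N f (fun u => (kernelConst τ η N)⁻¹ * sklyaninKernel τ η N v u) = f v := by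
  have hcj := continuous_conj
  have hfc := hf.1.continuous
  have hW := continuous_weight_conj hτ hτ' hη
  have hK : Continuous fun x : ℂ × ℂ => thetaProd τ η N x.1 (conj x.2) :=
    (contDiff_thetaProd hτ' η N (m := 1)).continuous.comp
      (f := fun x : ℂ × ℂ => (x.1, conj x.2)) (by fun_prop)
  have hF : Continuous fun x : ℂ × ℂ => metricIntegrand τ η N f
      (fun u => (kernelConst τ η N)⁻¹ * sklyaninKernel τ η N x.1 u) x.2 := by
    simp only [metricIntegrand, map_mul, conj_sklyaninKernel hτ hη]
    exact ((hfc.comp continuous_snd).mul (continuous_const.mul (continuous_const.mul hK))).mul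
      (hW.comp continuous_snd)
  have hc : Continuous fun v => metric τ η N f
      (fun u => (kernelConst τ η N)⁻¹ * sklyaninKernel τ η N v u) := by
    have he : ∀ v, metric τ η N f (fun u => (kernelConst τ η N)⁻¹ * sklyaninKernel τ η N v u) =
        ∫ x : ℝ in 0..1, ∫ y : ℝ in 0..τ.im, metricIntegrand τ η N f
          (fun u => (kernelConst τ η N)⁻¹ * sklyaninKernel τ η N v u) (x + y * I) := fun v =>
      setIntegral_periodDomain hτ' (hF.comp (Continuous.prodMk_right v))
    simp only [he]
    refine intervalIntegral.continuous_parametric_intervalIntegral_of_continuous' ?_ _ _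
    refine intervalIntegral.continuous_parametric_intervalIntegral_of_continuous'
      (f := fun (z : ℂ × ℝ) (y : ℝ) => metricIntegrand τ η N f
          (fun u => (kernelConst τ η N)⁻¹ * sklyaninKernel τ η N z.1 u) (z.2 + y * I)) ?_ _ _
    exact hF.comp (f := fun x : (ℂ × ℝ) × ℝ => (x.1.1, (x.1.2 + x.2 * I : ℂ))) (by fun_prop)
  -- Both sides are continuous in `v`, and the points with `2v` outside the lattice are dense.
  exact congrFun (Continuous.ext_on (dense_two_mul_notMem_lattice τ) hc hfc
    fun v hv => metric_kernel_of_notMem hτ hτ' hη hf hv) v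

end

end SklyaninKernel

end

theorem theorem3p2 (τ : ℂ) (hτre : τ.re = 0) (hτim : 0 < τ.im) (N : ℕ) (η : ℂ)
    (hη : η ∈ SklyaninKernel.realRange N ∪ SklyaninKernel.imagRange τ N) :
    (∀ f ∈ SklyaninKernel.Theta τ N, ∀ g ∈ SklyaninKernel.Theta τ N,
      IntegrableOn (SklyaninKernel.metricIntegrand τ η N f g) (SklyaninKernel.periodDomain τ)) ∧
    SklyaninKernel.IsReproducingKernel (SklyaninKernel.Theta τ N) (SklyaninKernel.metric τ η N)
      (fun v u => (SklyaninKernel.kernelConst τ η N)⁻¹ * SklyaninKernel.sklyaninKernel τ η N v u) := by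
  have hη' := SklyaninKernel.admissible_of_mem hη
  refine ⟨fun f hf g hg => SklyaninKernel.integrableOn_periodDomain τ
    (SklyaninKernel.continuous_metricIntegrand hτre hτim hη' hf.1.continuous hg.1.continuous),
    SklyaninKernel.isScalarProduct_metric hτre hτim hη', fun v => ?_, fun f hf v => ?_⟩
  · exact Submodule.smul_mem _ _ (SklyaninKernel.sklyaninKernel_mem hτre hτim η v)
  · exact (SklyaninKernel.metric_kernel hτre hτim hη' hf v).symm
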